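/- Let $T$ be a countable tree without vertices of degree $1$ (infinite degrees are allowed), with root $o$, and let $P=(p(x,y))_{x,y\in T}$ be a stochastic matrix with $p(x,y)>0$ if and only if $x\sim y$ (neighbours). Let $\pi(x,y)$ be the geodesic path from $x$ to $y$, let $x^-$ be the neighbour of $x\neq o$ on $\pi(o,x)$, and let $p^{(n)}(x,y)$ be the entries of $P^n$. Let $\mathsf m(x)=\prod_{i=1}^k p(x_{i-1},x_i)/p(x_i,x_{i-1})$ when $\pi(o,x)=[x_0,\dots,x_k]$; then $P$ acts as a bounded self-adjoint operator on $\ell^2(T,\mathsf m)$ by $Pf(x)=\sum_y p(x,y)f(y)$. Let $\rho=\limsup_n p^{(n)}(o,o)^{1/n}$, and call $P$ $\rho$-transient if $\sum_n p^{(n)}(x,y)\rho^{-n-1}<\infty$ for all $x,y$. For $\lambda\in\mathbb C$ in the resolvent set of $P$ on $\ell^2(T,\mathsf m)$ let $G(x,y|\lambda)=\big((\lambda I-P)^{-1}\mathbf 1_y\big)(x)$, and let $\mathrm{res}^*(P)$ be the set of those $\lambda$ in the resolvent set with $G(x,x|\lambda)\neq 0$ for all $x$. In the $\rho$-transient case let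 $G(x,y|\lambda)=\sum_{n\ge 0}p^{(n)}(x,y)\lambda^{-n-1}$ for $\lambda=\pm\rho$. Let $F(x,y|\lambda)=G(x,y|\lambda)/G(y,y|\lambda)$. Let $\partial T$ be the set of ends of $T$ (equivalence classes of geodesic rays, two rays being equivalent if they differ by finitely many initial vertices), and let $\partial T_x$ be the set of ends having a representative ray in $T_x=\{w: x\in\pi(o,w)\}$, so that $\partial T_o=\partial T$. A function on $T$ is locally constant if it changes its value along only finitely many edges, and $\partial\mathcal V$ is the space of functions on $\partial T$ obtained as limits of such functions along rays. A distribution is a linear functional $\nu$ on $\partial\mathcal V$; write $\int_{\partial T}\varphi\,d\nu=\nu(\varphi)$ and $\nu(\partial T_x)=\nu(\mathbf 1_{\partial T_x})$. It is strong if for every $x\in T$ the series $\sum_{y:\,y^-=x}\nu(\partial T_y)$ converges absolutely, with sum $\nu(\partial T_x)$. The $\lambda$-Martin kernel is $K(x,\xi|\lambda)=G(x,v|\lambda)/G(o,v|\lambda)$, where $v=x\wedge\xi$ is the last common vertex of $\pi(o,x)$ and the geodesic ray from $o$ to $\xi$. Let $\lambda\in\mathrm{res}^*(P)$, or let $\lambda=\pm\rho$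 in the $\rho$-transient case. Then $G(x,y|\lambda)\neq 0$ for all $x,y$, and $F(x^-,x|\lambda)F(x,x^-|\lambda)\neq 1$ for all $x\neq o$. For every $\lambda$-harmonic function $h:T\to\mathbb C$ (that is, $\sum_y p(x,y)h(y)$ converges absolutely with sum $\lambda h(x)$ for every $x$), there is a unique strong distribution $\nu=\nu^h$ on $\partial T$ such that $$h(x)=\int_{\partial T}K(x,\xi|\lambda)\,d\nu(\xi)\qquad\text{for all }x\in T$$ (where $K(x,\cdot|\lambda)\in\partial\mathcal V$ for every $x$). It is given by $$\nu^h(\partial T)=h(o),\qquad \nu^h(\partial T_x)=F(o,x|\lambda)\,\frac{h(x)-F(x,x^-|\lambda)\,h(x^-)}{1-F(x^-,x|\lambda)\,F(x,x^-|\lambda)}\quad(x\neq o).$$ -/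

import Mathlib

open scoped ENNReal

namespace TreeWalk

variable {V : Type*} {G : SimpleGraph V}

section Geodesics

/-- The geodesic path `π(x,y)`: the unique path from `x` to `y` in the tree `G`. -/
noncomputable def geod (hT : G.IsTree) (x y : V) : G.Walk x y :=
  (hT.existsUnique_path x y).choose

theorem geod_isPath (hT : G.IsTree) (x y : V) : (geod hT x y).IsPath :=
  (hT.existsUnique_path x y).choose_spec.1

theorem eq_geod (hT : G.IsTree) {x y : V} {q : G.Walk x y} (hq : q.IsPath) :
    q = geod hT x y :=
  (hT.existsUnique_path x y).unique hq (geod_isPath hT x y)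

theorem geod_concat (hT : G.IsTree) {o v w : V} (h : G.Adj v w)
    (hw : w ∉ (geod hT o v).support) : geod hT o w = (geod hT o v).concat h :=
  (eq_geod hT ((geod_isPath hT o v).concat hw h)).symm

theorem not_mem_geod (hT : G.IsTree) {o v w : V} (h : G.Adj v w)
    (hw : w ∈ (geod hT o v).support) : v ∉ (geod hT o w).support := by
  classical
  rw [← eq_geod hT ((geod_isPath hT o v).takeUntil hw)]
  exact SimpleGraph.Walk.endpoint_notMem_support_takeUntil (geod_isPath hT o v) hw h.ne

/-- The predecessor `x⁻` of `x` with respect to the root `o`: the neighbour of `x` on `π(o,x)`.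
It is only used for `x ≠ o`. -/
noncomputable def pred (hT : G.IsTree) (o x : V) : V := (geod hT o x).penultimate

/-- The set of forward neighbours of `x`, i.e. the `y ≠ o` with `y⁻ = x`. -/
def forward (hT : G.IsTree) (o x : V) : Set V := {y | y ≠ o ∧ pred hT o y = x}

/-- The cone `T_{x,y}`: all vertices `w` with `y ∈ π(x,w)`.  With `x = o` the root, this is `T_y`
(and `T_o` is the whole tree). -/
def cone (hT : G.IsTree) (x y : V) : Set V := {w | y ∈ (geod hT x w).support}

theorem cone_adj (hT : G.IsTree) {o x v w : V} (h : G.Adj v w) (hv : v ∈ cone hT o x)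
    (hw : w ∉ cone hT o x) : v = x ∧ w = pred hT o x := by
  by_cases hmem : w ∈ (geod hT o v).support
  · have hn := not_mem_geod hT h hmem
    have hc := geod_concat hT h.symm hn
    have hvx : v = x := by
      have hv' : x ∈ (geod hT o v).support := hv
      rw [hc, SimpleGraph.Walk.support_concat] at hv'
      have hw' : x ∉ (geod hT o w).support := hw
      simp only [List.mem_append, List.mem_singleton] at hv'
      rcases hv' with h1 | h1
      · exact absurd h1 hw'
      · exact h1.symm
    subst hvx
    refine ⟨rfl, ?_⟩
    unfold pred
    rw [hc, SimpleGraph.Walk.penultimate_concat]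
  · exfalso
    apply hw
    change x ∈ (geod hT o w).support
    rw [geod_concat hT h hmem, SimpleGraph.Walk.support_concat]
    have hv' : x ∈ (geod hT o v).support := hv
    simp [hv']

end Geodesics

section Boundary

/-- A geodesic ray: consecutive vertices are neighbours and there is no backtracking. -/
structure Ray (G : SimpleGraph V) where
  toFun : ℕ → V
  adj : ∀ n, G.Adj (toFun n) (toFun (n + 1))
  nonbacktracking : ∀ n, toFun (n + 2) ≠ toFun n

/-- Two rays are equivalent if they differ by finitely many initial vertices. -/
def rayEquiv (r s : Ray G) : Prop := ∃ m n, ∀ k, r.toFun (m + k) = s.toFun (n + k)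

instance raySetoid (G : SimpleGraph V) : Setoid (Ray G) where
  r := rayEquiv
  iseqv := by
    refine ⟨fun r => ⟨0, 0, fun _ => rfl⟩, ?_, ?_⟩
    · rintro r s ⟨m, n, h⟩
      exact ⟨n, m, fun k => (h k).symm⟩
    · rintro r s t ⟨m, n, h⟩ ⟨m', n', h'⟩
      refine ⟨m + m', n' + n, fun k => ?_⟩
      have h1 := h (m' + k)
      have h2 := h' (n + k)
      rw [show m + m' + k = m + (m' + k) by ring, h1,
        show n + (m' + k) = m' + (n + k) by ring, h2, show n' + n + k = n' + (n + k) by ring]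

/-- The boundary `∂T`: the set of ends, i.e. of equivalence classes of rays. -/
def Boundary (G : SimpleGraph V) : Type _ := Quotient (raySetoid G)

/-- The end represented by a ray. -/
def toEnd (r : Ray G) : Boundary G := Quotient.mk (raySetoid G) r

/-- The boundary arc `∂T_{x,y}`: the ends which have a representative ray in `T_{x,y}`. -/
def arc (hT : G.IsTree) (x y : V) : Set (Boundary G) :=
  {ξ | ∃ r : Ray G, toEnd r = ξ ∧ ∀ n, r.toFun n ∈ cone hT x y}

/-- The vertex `v` lies on the geodesic ray `π(o,ξ)`, the ray starting at `o` and representing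
the end `ξ`. -/
def OnGeodesicRay (o : V) (ξ : Boundary G) (v : V) : Prop :=
  ∃ r : Ray G, r.toFun 0 = o ∧ toEnd r = ξ ∧ ∃ n, r.toFun n = v

open Classical in
/-- The confluent `x ∧ ξ` with respect to `o` of a vertex and an end: the last vertex of `π(o,x)`
that also lies on `π(o,ξ)`. -/
noncomputable def confluent (hT : G.IsTree) (o x : V) (ξ : Boundary G) : V :=
  (geod hT o x).getVert
    (Nat.findGreatest (fun i => OnGeodesicRay o ξ ((geod hT o x).getVert i))
      (geod hT o x).length)

/-- A function on the vertex set is locally constant if it changes its value along finitely many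
edges only. -/
def LocallyConst (G : SimpleGraph V) (f : V → ℂ) : Prop :=
  {e : V × V | G.Adj e.1 e.2 ∧ f e.1 ≠ f e.2}.Finite

/-- The space `∂𝒱` of locally constant functions on the boundary: the traces on `∂T` of the locally
constant functions on `T`. The trace of `f` at an end is the eventual value of `f` along any ray
representing the end, i.e. the value of the continuous extension of `f`. -/
def boundaryLocConst (G : SimpleGraph V) : Submodule ℂ (Boundary G → ℂ) where
  carrier := {φ | ∃ f : V → ℂ, LocallyConst G f ∧
    ∀ r : Ray G, ∀ᶠ n in Filter.atTop, f (r.toFun n) = φ (toEnd r)}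
  zero_mem' := ⟨fun _ => 0, by simp [LocallyConst], fun r => by simp⟩
  add_mem' := by
    rintro φ ψ ⟨f, hf, hf'⟩ ⟨g, hg, hg'⟩
    refine ⟨f + g, (hf.union hg).subset ?_, fun r => ?_⟩
    · rintro ⟨a, b⟩ ⟨hab, hne⟩
      by_contra hcon
      simp only [Set.mem_union, Set.mem_ofPred_eq, not_or, not_and, not_not] at hcon
      apply hne
      simp only [Pi.add_apply]
      rw [hcon.1 hab, hcon.2 hab]
    · filter_upwards [hf' r, hg' r] with n h1 h2
      simp [h1, h2]
  smul_mem' := by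
    rintro c φ ⟨f, hf, hf'⟩
    refine ⟨c • f, hf.subset ?_, fun r => ?_⟩
    · rintro ⟨a, b⟩ ⟨hab, hne⟩
      refine ⟨hab, fun h => hne ?_⟩
      simp only [Pi.smul_apply]
      rw [h]
    · filter_upwards [hf' r] with n h1
      simp [h1]

theorem ray_step (hT : G.IsTree) (r : Ray G) (n : ℕ) :
    r.toFun (n + 1) ∉ (geod hT (r.toFun 0) (r.toFun n)).support := by
  induction n with
  | zero =>
    rw [← eq_geod hT (SimpleGraph.Walk.IsPath.nil (u := r.toFun 0))]
    simpa using (r.adj 0).ne'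
  | succ n ih =>
    intro hmem
    have h1 := geod_concat hT (r.adj n) ih
    have h2 := geod_concat hT (r.adj (n + 1)).symm (not_mem_geod hT (r.adj (n + 1)) hmem)
    have h3 := congrArg SimpleGraph.Walk.penultimate h1
    have h4 := congrArg SimpleGraph.Walk.penultimate h2
    rw [SimpleGraph.Walk.penultimate_concat] at h3 h4
    exact r.nonbacktracking n (h4.symm.trans h3)

theorem ray_injective (hT : G.IsTree) (r : Ray G) : Function.Injective r.toFun := by
  have hlen : ∀ n, (geod hT (r.toFun 0) (r.toFun n)).length = n := by
    intro n
    induction n with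
    | zero => rw [← eq_geod hT (SimpleGraph.Walk.IsPath.nil (u := r.toFun 0))]; rfl
    | succ n ih =>
      rw [geod_concat hT (r.adj n) (ray_step hT r n), SimpleGraph.Walk.length_concat, ih]
  intro a b hab
  rw [← hlen a, ← hlen b, hab]

/-- The indicator function of a boundary arc `∂T_x` is locally constant. -/
theorem indicator_arc_mem (hT : G.IsTree) (o x : V) :
    (arc hT o x).indicator (fun _ => (1 : ℂ)) ∈ boundaryLocConst G := by
  classical
  refine ⟨(cone hT o x).indicator (fun _ => (1 : ℂ)), ?_, fun r => ?_⟩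
  · refine (Set.toFinite {(x, pred hT o x), (pred hT o x, x)}).subset ?_
    rintro ⟨a, b⟩ ⟨hab, hne⟩
    simp only at hab hne
    by_cases ha : a ∈ cone hT o x <;> by_cases hb : b ∈ cone hT o x
    · simp [ha, hb] at hne
    · obtain ⟨h1, h2⟩ := cone_adj hT hab ha hb
      simp [h1, h2]
    · obtain ⟨h1, h2⟩ := cone_adj hT hab.symm hb ha
      simp [h1, h2]
    · simp [ha, hb] at hne
  · have hev : ∃ N, ∀ n ≥ N, r.toFun n ≠ x := by
      by_cases hx : ∃ N, r.toFun N = x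
      · obtain ⟨N, hN⟩ := hx
        refine ⟨N + 1, fun n hn h => ?_⟩
        have := ray_injective hT r (h.trans hN.symm)
        omega
      · push Not at hx
        exact ⟨0, fun n _ => hx n⟩
    obtain ⟨N, hN⟩ := hev
    have hconst : ∀ k, (r.toFun (N + k) ∈ cone hT o x ↔ r.toFun N ∈ cone hT o x) := by
      intro k
      induction k with
      | zero => rfl
      | succ k ih =>
        rw [← ih]
        constructor
        · intro h1
          by_contra h2
          exact hN (N + (k + 1)) (by omega) (cone_adj hT (r.adj (N + k)).symm h1 h2).1
        · intro h1
          by_contra h2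
          exact hN (N + k) (by omega) (cone_adj hT (r.adj (N + k)) h1 h2).1
    have harc : toEnd r ∈ arc hT o x ↔ r.toFun N ∈ cone hT o x := by
      constructor
      · rintro ⟨s, hs, hs'⟩
        obtain ⟨m, n, hmn⟩ : rayEquiv s r := Quotient.exact hs
        rw [← hconst n, show N + n = n + N by ring, ← hmn N]
        exact hs' _
      · intro h
        refine ⟨⟨fun k => r.toFun (N + k), fun k => r.adj (N + k),
          fun k => r.nonbacktracking (N + k)⟩, ?_, fun k => (hconst k).2 h⟩
        exact Quotient.sound ⟨0, N, fun k => by simp⟩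
    refine Filter.eventually_atTop.2 ⟨N, fun n hn => ?_⟩
    obtain ⟨k, rfl⟩ := Nat.exists_eq_add_of_le hn
    by_cases h : r.toFun N ∈ cone hT o x
    · rw [Set.indicator_of_mem ((hconst k).2 h), Set.indicator_of_mem (harc.2 h)]
    · rw [Set.indicator_of_notMem (fun h' => h ((hconst k).1 h')),
        Set.indicator_of_notMem (fun h' => h (harc.1 h'))]

/-- A (complex) distribution on `∂T`: an element of the dual space of `∂𝒱`. -/
abbrev Distribution (G : SimpleGraph V) : Type _ := Module.Dual ℂ (boundaryLocConst G)

/-- The value `ν(∂T_x)` of a distribution on a boundary arc. -/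
noncomputable def arcMass (hT : G.IsTree) (o : V) (ν : Distribution G) (x : V) : ℂ :=
  ν ⟨(arc hT o x).indicator (fun _ => (1 : ℂ)), indicator_arc_mem hT o x⟩

/-- A distribution is strong if for every vertex `x`, the series of the `ν(∂T_y)`, `y⁻ = x`,
converges absolutely, with sum `ν(∂T_x)`. -/
def IsStrong (hT : G.IsTree) (o : V) (ν : Distribution G) : Prop :=
  ∀ x, Summable (fun y : forward hT o x => ‖arcMass hT o ν y‖) ∧
    arcMass hT o ν x = ∑' y : forward hT o x, arcMass hT o ν y

/-- `∫ φ dν = c`: the function `φ` is locally constant on `∂T` and `ν(φ) = c`. -/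
def HasBoundaryIntegral (ν : Distribution G) (φ : Boundary G → ℂ) (c : ℂ) : Prop :=
  ∃ hφ : φ ∈ boundaryLocConst G, ν ⟨φ, hφ⟩ = c

end Boundary

/-- The transition matrix of a nearest neighbour random walk on `G`. -/
structure NNWalk (G : SimpleGraph V) where
  p : V → V → ℝ
  nonneg : ∀ x y, 0 ≤ p x y
  pos_iff : ∀ x y, 0 < p x y ↔ G.Adj x y
  hasSum : ∀ x, HasSum (p x) 1

namespace NNWalk

variable (W : NNWalk G)

/-- `h` is `lam`-harmonic: `∑_y p(x,y) h(y)` converges absolutely and equals `lam * h(x)`. -/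
def IsHarmonic (lam : ℂ) (h : V → ℂ) : Prop :=
  ∀ x, Summable (fun y => ‖(W.p x y : ℂ) * h y‖) ∧ ∑' y, (W.p x y : ℂ) * h y = lam * h x

open Classical in
/-- The `n`-step transition probabilities `p⁽ⁿ⁾(x,y)`, the entries of `Pⁿ`. -/
noncomputable def pn : ℕ → V → V → ℝ
  | 0, x, y => if x = y then 1 else 0
  | n + 1, x, y => ∑' z, W.p x z * pn n z y

/-- The spectral radius `ρ(P) = limsup p⁽ⁿ⁾(x,y)^{1/n}`, which does not depend on `x`, `y`; we take
`x = y = o`. -/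
noncomputable def rho (o : V) : ℝ :=
  Filter.limsup (fun n : ℕ => (W.pn n o o) ^ (1 / (n : ℝ))) Filter.atTop

/-- The walk is `ρ`-transient: `G(x,y|ρ) = ∑ₙ p⁽ⁿ⁾(x,y) ρ^{-n-1}` converges for all `x`, `y`. -/
def RhoTransient (o : V) : Prop :=
  ∀ x y, Summable (fun n : ℕ => W.pn n x y / W.rho o ^ (n + 1))

/-- The power series `∑ₙ p⁽ⁿ⁾(x,y) lam^{-n-1}`. -/
noncomputable def greenSeries (lam : ℂ) (x y : V) : ℂ :=
  ∑' n : ℕ, (W.pn n x y : ℂ) / lam ^ (n + 1)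

/-- The reversing weights `m(x)`: the product of `p(x_{i-1},x_i) / p(x_i,x_{i-1})` along
`π(o,x)`. -/
noncomputable def m (hT : G.IsTree) (o x : V) : ℝ :=
  ((geod hT o x).darts.map fun d => W.p d.fst d.snd / W.p d.snd d.fst).prod

theorem m_pos (hT : G.IsTree) (o x : V) : 0 < W.m hT o x := by
  unfold m
  apply List.prod_pos
  intro a ha
  obtain ⟨d, _, rfl⟩ := List.mem_map.1 ha
  exact div_pos ((W.pos_iff _ _).2 d.adj) ((W.pos_iff _ _).2 d.adj.symm)

theorem m_concat (hT : G.IsTree) {o x y : V} (h : G.Adj x y)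
    (hy : y ∉ (geod hT o x).support) : W.m hT o x * W.p x y = W.m hT o y * W.p y x := by
  have hp := (W.pos_iff y x).2 h.symm
  unfold m
  rw [geod_concat hT h hy, SimpleGraph.Walk.darts_concat]
  simp only [List.concat_eq_append, List.map_append, List.prod_append, List.map_cons,
    List.map_nil, List.prod_cons, List.prod_nil, mul_one]
  field_simp

/-- Reversibility. -/
theorem m_symm (hT : G.IsTree) (o x y : V) :
    W.m hT o x * W.p x y = W.m hT o y * W.p y x := by
  by_cases h : G.Adj x y
  · by_cases hy : y ∈ (geod hT o x).support
    · exact (W.m_concat hT h.symm (not_mem_geod hT h hy)).symm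
    · exact W.m_concat hT h hy
  · have h1 : W.p x y = 0 :=
      le_antisymm (not_lt.1 fun h' => h ((W.pos_iff _ _).1 h')) (W.nonneg _ _)
    have h2 : W.p y x = 0 :=
      le_antisymm (not_lt.1 fun h' => h ((W.pos_iff _ _).1 h').symm) (W.nonneg _ _)
    rw [h1, h2, mul_zero, mul_zero]

/-- The measure on (the discrete space) `T` with point masses `m(x)`. -/
noncomputable def mMeasure (hT : G.IsTree) (o : V) : @MeasureTheory.Measure V ⊤ :=
  MeasureTheory.Measure.sum (m0 := ⊤) fun x =>
    ENNReal.ofReal (W.m hT o x) • @MeasureTheory.Measure.dirac V ⊤ x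

/-- The Hilbert space `ℓ²(T,m)`. -/
abbrev ell2 (hT : G.IsTree) (o : V) : Type _ := MeasureTheory.Lp ℂ 2 (W.mMeasure hT o)

theorem lintegral_mMeasure (hT : G.IsTree) (o : V) (f : V → ℝ≥0∞) :
    ∫⁻ x, f x ∂(W.mMeasure hT o) = ∑' x, ENNReal.ofReal (W.m hT o x) * f x := by
  let _ : MeasurableSpace V := ⊤
  unfold mMeasure
  rw [MeasureTheory.lintegral_sum_measure]
  simp [MeasureTheory.lintegral_smul_measure]

theorem mMeasure_singleton (hT : G.IsTree) (o x : V) :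
    W.mMeasure hT o {x} = ENNReal.ofReal (W.m hT o x) := by
  let _ : MeasurableSpace V := ⊤
  classical
  rw [← MeasureTheory.lintegral_indicator_one (MeasurableSpace.measurableSet_top),
    lintegral_mMeasure, tsum_eq_single x]
  · simp
  · intro y hy
    simp [hy]

theorem eq_of_ae_eq (hT : G.IsTree) {o : V} {f g : V → ℂ}
    (h : f =ᵐ[W.mMeasure hT o] g) : f = g := by
  let _ : MeasurableSpace V := ⊤
  funext x
  by_contra hne
  have h0 : W.mMeasure hT o {x} = 0 :=
    MeasureTheory.measure_mono_null (by simpa using hne) (MeasureTheory.ae_iff.1 h)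
  rw [mMeasure_singleton, ENNReal.ofReal_eq_zero] at h0
  exact absurd (W.m_pos hT o x) (not_lt.2 h0)

/-- The action `Pf(x) = ∑_y p(x,y) f(y)`. -/
noncomputable def act (f : V → ℂ) (x : V) : ℂ := ∑' y, (W.p x y : ℂ) * f y

theorem tsum_p (x : V) : ∑' y, ENNReal.ofReal (W.p x y) = 1 := by
  rw [← ENNReal.ofReal_tsum_of_nonneg (W.nonneg x) (W.hasSum x).summable, (W.hasSum x).tsum_eq,
    ENNReal.ofReal_one]

theorem jensen (f : V → ℂ) (x : V) :
    (∑' y, ‖(W.p x y : ℂ) * f y‖ₑ) ^ 2 ≤ ∑' y, ENNReal.ofReal (W.p x y) * ‖f y‖ₑ ^ 2 := by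
  let _ : MeasurableSpace V := ⊤
  let Q : MeasureTheory.Measure V := MeasureTheory.Measure.sum fun y =>
    ENNReal.ofReal (W.p x y) • MeasureTheory.Measure.dirac y
  have hQ : ∀ g : V → ℝ≥0∞, ∫⁻ y, g y ∂Q = ∑' y, ENNReal.ofReal (W.p x y) * g y := by
    intro g
    simp [Q, MeasureTheory.lintegral_sum_measure, MeasureTheory.lintegral_smul_measure]
  have : MeasureTheory.IsProbabilityMeasure Q := by
    constructor
    rw [← MeasureTheory.lintegral_one, hQ]
    simpa using W.tsum_p x
  have h := MeasureTheory.eLpNorm_le_eLpNorm_of_exponent_le (μ := Q) (f := f) (p := 1) (q := 2)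
    (by norm_num) measurable_from_top.aestronglyMeasurable
  rw [MeasureTheory.eLpNorm_one_eq_lintegral_enorm] at h
  have h2 : MeasureTheory.eLpNorm f 2 Q ^ 2 = ∫⁻ y, ‖f y‖ₑ ^ 2 ∂Q := by
    have := MeasureTheory.eLpNorm_nnreal_pow_eq_lintegral (μ := Q) (f := f) (p := 2) (by norm_num)
    simpa using this
  calc (∑' y, ‖(W.p x y : ℂ) * f y‖ₑ) ^ 2 = (∫⁻ y, ‖f y‖ₑ ∂Q) ^ 2 := by
        rw [hQ]
        congr 1
        refine tsum_congr fun y => ?_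
        rw [enorm_mul, ← ofReal_norm, Complex.norm_real, Real.norm_of_nonneg (W.nonneg x y)]
    _ ≤ MeasureTheory.eLpNorm f 2 Q ^ 2 := by gcongr
    _ = _ := by rw [h2, hQ]

theorem eLpNorm_sq (hT : G.IsTree) (o : V) (f : V → ℂ) :
    MeasureTheory.eLpNorm f 2 (W.mMeasure hT o) ^ 2
      = ∑' x, ENNReal.ofReal (W.m hT o x) * ‖f x‖ₑ ^ 2 := by
  have := MeasureTheory.eLpNorm_nnreal_pow_eq_lintegral (μ := W.mMeasure hT o) (f := f) (p := 2)
    (by norm_num)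
  rw [← lintegral_mMeasure]
  simpa using this

theorem tsum_act_le (hT : G.IsTree) (o : V) (f : V → ℂ) :
    ∑' x, ENNReal.ofReal (W.m hT o x) * (∑' y, ‖(W.p x y : ℂ) * f y‖ₑ) ^ 2
      ≤ ∑' x, ENNReal.ofReal (W.m hT o x) * ‖f x‖ₑ ^ 2 := by
  calc _ ≤ ∑' x, ENNReal.ofReal (W.m hT o x) * ∑' y, ENNReal.ofReal (W.p x y) * ‖f y‖ₑ ^ 2 := by
        gcongr with x
        exact W.jensen f x
    _ = ∑' x, ∑' y, ENNReal.ofReal (W.m hT o y) * ENNReal.ofReal (W.p y x) * ‖f y‖ₑ ^ 2 := by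
        refine tsum_congr fun x => ?_
        rw [← ENNReal.tsum_mul_left]
        refine tsum_congr fun y => ?_
        rw [← mul_assoc, ← ENNReal.ofReal_mul (W.m_pos hT o x).le, W.m_symm,
          ENNReal.ofReal_mul (W.m_pos hT o y).le]
    _ = ∑' y, ∑' x, ENNReal.ofReal (W.m hT o y) * ENNReal.ofReal (W.p y x) * ‖f y‖ₑ ^ 2 :=
        ENNReal.tsum_comm
    _ = _ := by
        refine tsum_congr fun y => ?_
        rw [ENNReal.tsum_mul_right, ENNReal.tsum_mul_left, W.tsum_p, mul_one]

theorem eLpNorm_act_le (hT : G.IsTree) (o : V) (f : V → ℂ) :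
    MeasureTheory.eLpNorm (W.act f) 2 (W.mMeasure hT o)
      ≤ MeasureTheory.eLpNorm f 2 (W.mMeasure hT o) := by
  rw [← ENNReal.pow_le_pow_left_iff two_ne_zero, eLpNorm_sq, eLpNorm_sq]
  refine le_trans ?_ (W.tsum_act_le hT o f)
  gcongr with x
  exact enorm_tsum_le_tsum_enorm

theorem act_memLp (hT : G.IsTree) (o : V) (f : W.ell2 hT o) :
    MeasureTheory.MemLp (W.act f) 2 (W.mMeasure hT o) :=
  let _ : MeasurableSpace V := ⊤
  ⟨measurable_from_top.aestronglyMeasurable,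
    (W.eLpNorm_act_le hT o f).trans_lt (MeasureTheory.Lp.memLp f).2⟩

theorem summable_act (hT : G.IsTree) (o : V) (f : W.ell2 hT o) (x : V) :
    Summable fun y => (W.p x y : ℂ) * f y := by
  have h : ∑' x, ENNReal.ofReal (W.m hT o x) * (∑' y, ‖(W.p x y : ℂ) * f y‖ₑ) ^ 2 ≠ ⊤ := by
    refine ne_top_of_le_ne_top ?_ (W.tsum_act_le hT o f)
    rw [← eLpNorm_sq]
    exact ENNReal.pow_ne_top (MeasureTheory.Lp.memLp f).2.ne
  have h1 := ENNReal.ne_top_of_tsum_ne_top h x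
  have h2 : ∑' y, ‖(W.p x y : ℂ) * f y‖ₑ ≠ ⊤ := by
    intro htop
    rw [htop] at h1
    apply h1
    rw [ENNReal.top_pow two_ne_zero, ENNReal.mul_top]
    exact (ENNReal.ofReal_pos.2 (W.m_pos hT o x)).ne'
  exact (tsum_enorm_ne_top_iff_summable_norm.1 h2).of_norm

/-- The transition operator `P` as a bounded operator on `ℓ²(T,m)`. -/
noncomputable def P (hT : G.IsTree) (o : V) : W.ell2 hT o →L[ℂ] W.ell2 hT o :=
  LinearMap.mkContinuous
    { toFun := fun f => (W.act_memLp hT o f).toLp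
      map_add' := by
        intro f g
        rw [← MeasureTheory.MemLp.toLp_add]
        congr 1
        funext x
        have hfg := W.eq_of_ae_eq hT (MeasureTheory.Lp.coeFn_add f g)
        simp only [act, Pi.add_apply]
        rw [← (W.summable_act hT o f x).tsum_add (W.summable_act hT o g x)]
        refine tsum_congr fun y => ?_
        rw [hfg, Pi.add_apply, mul_add]
      map_smul' := by
        intro c f
        rw [RingHom.id_apply, ← MeasureTheory.MemLp.toLp_const_smul]
        congr 1
        funext x
        have hf := W.eq_of_ae_eq hT (MeasureTheory.Lp.coeFn_smul c f)
        simp only [act, Pi.smul_apply, smul_eq_mul]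
        rw [← tsum_mul_left]
        refine tsum_congr fun y => ?_
        rw [hf, Pi.smul_apply, smul_eq_mul]
        ring }
    1 (by
      intro f
      rw [one_mul]
      simp only [LinearMap.coe_mk, AddHom.coe_mk]
      rw [MeasureTheory.Lp.norm_toLp, MeasureTheory.Lp.norm_def]
      exact ENNReal.toReal_mono (MeasureTheory.Lp.memLp f).2.ne (W.eLpNorm_act_le hT o f))

/-- `P` acts on `ℓ²(T,m)` by the formula `Pf(x) = ∑_y p(x,y) f(y)`. -/
theorem P_apply (hT : G.IsTree) (o : V) (f : W.ell2 hT o) (x : V) :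
    (W.P hT o f : V → ℂ) x = ∑' y, (W.p x y : ℂ) * f y :=
  congrFun (W.eq_of_ae_eq hT (W.act_memLp hT o f).coeFn_toLp) x

/-- The indicator function `𝟏_y` as an element of `ℓ²(T,m)`. -/
noncomputable def delta (hT : G.IsTree) (o y : V) : W.ell2 hT o :=
  MeasureTheory.indicatorConstLp 2 (s := {y}) (MeasurableSpace.measurableSet_top)
    (by rw [mMeasure_singleton]; exact ENNReal.ofReal_ne_top) (1 : ℂ)

/-- The Green function `G(x,y|lam) = ((lam I - P)⁻¹ 𝟏_y)(x)` for `lam` in the resolvent set. -/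
noncomputable def green (hT : G.IsTree) (o : V) (lam : ℂ) (x y : V) : ℂ :=
  (resolvent (W.P hT o) lam (W.delta hT o y) : V → ℂ) x

/-- The set `res*(P)` of all `lam` in the resolvent set of `P` on `ℓ²(T,m)` such that
`G(x,x|lam) ≠ 0` for all `x`. -/
def resStar (hT : G.IsTree) (o : V) : Set ℂ :=
  {lam | lam ∈ resolventSet ℂ (W.P hT o) ∧ ∀ x, W.green hT o lam x x ≠ 0}

/-- `Gr` is the Green function at `lam`, either for `lam ∈ res*(P)`, or for `lam = ±ρ` in the
`ρ`-transient case (where it is given by the power series). -/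
def IsGreenAt (hT : G.IsTree) (o : V) (lam : ℂ) (Gr : V → V → ℂ) : Prop :=
  (lam ∈ W.resStar hT o ∧ Gr = W.green hT o lam) ∨
    (W.RhoTransient o ∧ (lam = (W.rho o : ℂ) ∨ lam = -(W.rho o : ℂ)) ∧ Gr = W.greenSeries lam)

end NNWalk

/-- The Green weights `F(x,y) = G(x,y) / G(y,y)`. -/
noncomputable def greenWeight (Gr : V → V → ℂ) (x y : V) : ℂ := Gr x y / Gr y y

/-- The Martin kernel `K(x,ξ) = G(x,v) / G(o,v)` with `v = x ∧ ξ`. -/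
noncomputable def martinKernel (hT : G.IsTree) (o : V) (Gr : V → V → ℂ) (x : V)
    (ξ : Boundary G) : ℂ :=
  Gr x (confluent hT o x ξ) / Gr o (confluent hT o x ξ)

end TreeWalk

/-!
The theorem is a linear-algebra statement about boundary arcs, once three facts on the Green
function `Gr` at `lam` are available (`IsGreenKernel`): the resolvent equation
`∑_w p(x,w) Gr(w,y) = lam Gr(x,y) - δ_x(y)`, nonvanishing on the diagonal, and the multiplicativity
`Gr(x,y) Gr(w,w) = Gr(x,w) Gr(w,y)` whenever `w` separates `x` from `y`.

These facts imply that `Gr` vanishes nowhere (`IsGreenKernel.ne_zero`) and that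
`p(x,y) Gr(x,x) (1 - F(x,y) F(y,x)) = F(x,y)` for neighbours (`IsGreenKernel.mul_one_sub`), so that
no denominator vanishes. They also give the recursion
`K(x,·) = F(x,x⁻) K(x⁻,·) + (1 - F(x⁻,x) F(x,x⁻)) / F(o,x) · 𝟏_{∂T_x}`
(`IsGreenKernel.martinKernel_eq`), by which a distribution represents `h` if and only if its arc
masses are given by the stated formula (`IsGreenKernel.represents_iff`). Since indicators of arcs
span the locally constant functions on `∂T`, uniqueness follows (`distribution_ext`).

For existence, the resolvent equation and the harmonicity of `h` show that the prescribed masses are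
additive over the forward neighbours of each vertex (`IsGreenKernel.hasSum_harmonicMass`). A
distribution with given additive masses `μ` is obtained by summation over the edges: a locally
constant `f` on `T` is sent to `f(o) μ(o) + ∑_{x ≠ o} (f(x) - f(x⁻)) μ(x)`
(`exists_distribution`). This depends on the trace of `f` on `∂T` only: as there are no finite
branches, a locally constant function with vanishing trace is finitely supported, and for such
functions the sum vanishes by additivity.

Multiplicativity is proved separately in the two cases. For `lam` in `res*(P)`, restricting
`G(·,y) - (G(w,y)/G(w,w)) G(·,w)` to the branch of `x` at `w` gives an element `u` of `ℓ²(T,m)` with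
`(lam I - P) u = c 𝟏_w` and `u(w) = 0`, which forces `u = 0` (`NNWalk.green_cut`). For `lam = ±ρ` it
is an identity between the coefficients of two Cauchy products, proved by induction on the
coefficient (`NNWalk.convolution_cut`). Here `ρ > 0`, and `G(x,x|-ρ) = -G(x,x|ρ) ≠ 0` as the tree is
bipartite.
-/

namespace TreeWalk

variable {V : Type*} {G : SimpleGraph V}

/-! ### Predecessors, levels and cones -/

theorem geod_self (hT : G.IsTree) (o : V) : geod hT o o = SimpleGraph.Walk.nil :=
  (eq_geod hT SimpleGraph.Walk.IsPath.nil).symm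

theorem geod_ne_nil (hT : G.IsTree) {o x : V} (hx : x ≠ o) : ¬ (geod hT o x).Nil := fun h =>
  hx ((geod_isPath hT o x).nil_iff_eq.1 h).symm

theorem adj_pred (hT : G.IsTree) {o x : V} (hx : x ≠ o) : G.Adj (pred hT o x) x :=
  SimpleGraph.Walk.adj_penultimate (geod_ne_nil hT hx)

theorem notMem_geod_pred (hT : G.IsTree) {o x : V} (hx : x ≠ o) :
    x ∉ (geod hT o (pred hT o x)).support := fun h =>
  not_mem_geod hT (adj_pred hT hx) h (SimpleGraph.Walk.getVert_mem_support _ _)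

theorem geod_eq_concat_pred (hT : G.IsTree) {o x : V} (hx : x ≠ o) :
    geod hT o x = (geod hT o (pred hT o x)).concat (adj_pred hT hx) :=
  geod_concat hT (adj_pred hT hx) (notMem_geod_pred hT hx)

/-- Of two neighbours, one is the predecessor of the other. -/
theorem adj_cases (hT : G.IsTree) (o : V) {v w : V} (h : G.Adj v w) :
    (w ≠ o ∧ pred hT o w = v) ∨ (v ≠ o ∧ pred hT o v = w) := by
  have key : ∀ {a b : V}, G.Adj a b → b ∉ (geod hT o a).support →
      b ≠ o ∧ pred hT o b = a := by
    intro a b hab hb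
    refine ⟨fun h => hb (h ▸ SimpleGraph.Walk.start_mem_support _), ?_⟩
    unfold pred
    rw [geod_concat hT hab hb, SimpleGraph.Walk.penultimate_concat]
  by_cases hw : w ∈ (geod hT o v).support
  · exact Or.inr (key h.symm (not_mem_geod hT h hw))
  · exact Or.inl (key h hw)

/-- The level `|x|` of a vertex: the length of `π(o,x)`. -/
noncomputable def level (hT : G.IsTree) (o x : V) : ℕ := (geod hT o x).length

theorem level_pred (hT : G.IsTree) {o x : V} (hx : x ≠ o) :
    level hT o x = level hT o (pred hT o x) + 1 := by
  unfold level
  rw [geod_eq_concat_pred hT hx, SimpleGraph.Walk.length_concat]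

/-- Induction along the tree, away from the root. -/
theorem pred_induction (hT : G.IsTree) (o : V) {p : V → Prop} (root : p o)
    (step : ∀ x, x ≠ o → p (pred hT o x) → p x) (x : V) : p x := by
  induction hn : level hT o x using Nat.strong_induction_on generalizing x with
  | _ n ih =>
    by_cases hx : x = o
    · exact hx ▸ root
    · exact step x hx (ih _ (by rw [← hn, level_pred hT hx]; omega) _ rfl)

theorem mem_cone_self (hT : G.IsTree) (o x : V) : x ∈ cone hT o x :=
  SimpleGraph.Walk.end_mem_support _

theorem root_mem_cone_iff (hT : G.IsTree) {o x : V} : o ∈ cone hT o x ↔ o = x := by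
  simp [cone, geod_self, eq_comm]

theorem mem_cone_iff_pred (hT : G.IsTree) {o x w : V} (hw : w ≠ o) :
    w ∈ cone hT o x ↔ w = x ∨ pred hT o w ∈ cone hT o x := by
  unfold cone
  simp only [Set.mem_ofPred_eq]
  rw [geod_eq_concat_pred hT hw, SimpleGraph.Walk.support_concat]
  simp [or_comm, eq_comm]

theorem pred_notMem_cone (hT : G.IsTree) {o x : V} (hx : x ≠ o) :
    pred hT o x ∉ cone hT o x := notMem_geod_pred hT hx

/-- A vertex has only finitely many ancestors. -/
theorem finite_ancestors (hT : G.IsTree) (o w : V) : {x | w ∈ cone hT o x}.Finite :=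
  (List.finite_toSet (geod hT o w).support).subset fun _ hx => hx

theorem adj_of_forward (hT : G.IsTree) {o x y : V} (hy : y ∈ forward hT o x) : G.Adj x y := by
  have := adj_pred hT hy.1
  rwa [hy.2] at this

/-- Each neighbour of `x` is the predecessor of `x` or a forward neighbour of `x`. -/
theorem adj_iff (hT : G.IsTree) {o x y : V} :
    G.Adj x y ↔ y ∈ forward hT o x ∨ (x ≠ o ∧ y = pred hT o x) := by
  constructor
  · intro h
    rcases adj_cases hT o h with h1 | h1
    · exact Or.inl h1
    · exact Or.inr ⟨h1.1, h1.2.symm⟩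
  · rintro (h | ⟨h, rfl⟩)
    · exact adj_of_forward hT h
    · exact (adj_pred hT h).symm

theorem pred_notMem_forward (hT : G.IsTree) {o x : V} (hx : x ≠ o) :
    pred hT o x ∉ forward hT o x := by
  rintro ⟨h1, h2⟩
  have h3 := level_pred hT hx
  have h4 := level_pred hT h1
  rw [h2] at h4
  omega

/-! ### Rays and ends -/

theorem ray_ext_of_equiv {r s : Ray G} (h : toEnd r = toEnd s) :
    ∃ m n, ∀ k, r.toFun (m + k) = s.toFun (n + k) := Quotient.exact h

/-- Equivalent rays eventually have the same properties. -/
theorem eventually_of_toEnd_eq {r s : Ray G} (h : toEnd r = toEnd s) {p : V → Prop}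
    (hs : ∀ᶠ n in Filter.atTop, p (s.toFun n)) : ∀ᶠ n in Filter.atTop, p (r.toFun n) := by
  obtain ⟨m, n, hmn⟩ := ray_ext_of_equiv h
  obtain ⟨N, hN⟩ := Filter.eventually_atTop.1 hs
  refine Filter.eventually_atTop.2 ⟨m + N, fun j hj => ?_⟩
  obtain ⟨k, rfl⟩ := Nat.exists_eq_add_of_le hj
  rw [add_assoc, hmn]
  exact hN _ (by omega)

theorem exists_ray_adj (r : Ray G) {a : V} (ha : G.Adj a (r.toFun 0)) :
    ∃ s : Ray G, s.toFun 0 = a ∧ toEnd s = toEnd r := by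
  by_cases h : r.toFun 1 = a
  · exact ⟨⟨fun k => r.toFun (k + 1), fun k => r.adj (k + 1), fun k => r.nonbacktracking (k + 1)⟩,
      h, Quotient.sound ⟨0, 1, fun k => by simp [add_comm]⟩⟩
  · refine ⟨⟨fun k => Nat.casesOn k a r.toFun, ?_, ?_⟩, rfl,
      Quotient.sound ⟨1, 0, fun k => by simp [add_comm]⟩⟩
    · rintro (_ | n)
      · exact ha
      · exact r.adj n
    · rintro (_ | n)
      · exact h
      · exact r.nonbacktracking n

/-- Every end is represented by a ray that starts at a given vertex. -/
theorem exists_ray_from (hT : G.IsTree) (o : V) (ξ : Boundary G) :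
    ∃ r : Ray G, r.toFun 0 = o ∧ toEnd r = ξ := by
  obtain ⟨r, rfl⟩ := Quotient.exists_rep ξ
  have key : ∀ {a b : V} (_ : G.Walk a b), (∃ s : Ray G, s.toFun 0 = b ∧ toEnd s = toEnd r) →
      ∃ s : Ray G, s.toFun 0 = a ∧ toEnd s = toEnd r := by
    intro a b q
    induction q with
    | nil => exact id
    | cons hab _ ih =>
      intro h
      obtain ⟨s, hs, hs'⟩ := ih h
      obtain ⟨t, ht, ht'⟩ := exists_ray_adj s (hs ▸ hab)
      exact ⟨t, ht, ht'.trans hs'⟩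
  exact key (geod hT o (r.toFun 0)) ⟨r, rfl, rfl⟩

theorem ray_succ_ne_root (hT : G.IsTree) (r : Ray G) (n : ℕ) : r.toFun (n + 1) ≠ r.toFun 0 :=
  fun h => by simpa using ray_injective hT r h

theorem pred_ray (hT : G.IsTree) (r : Ray G) (n : ℕ) :
    pred hT (r.toFun 0) (r.toFun (n + 1)) = r.toFun n := by
  unfold pred
  rw [geod_concat hT (r.adj n) (ray_step hT r n), SimpleGraph.Walk.penultimate_concat]

/-- The ancestors of a vertex on a ray from the root are the preceding vertices of the ray. -/
theorem ray_mem_cone_iff (hT : G.IsTree) (r : Ray G) (n : ℕ) (x : V) :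
    r.toFun n ∈ cone hT (r.toFun 0) x ↔ ∃ j ≤ n, r.toFun j = x := by
  induction n with
  | zero => simp [root_mem_cone_iff]
  | succ n ih =>
    rw [mem_cone_iff_pred hT (ray_succ_ne_root hT r n), pred_ray, ih]
    constructor
    · rintro (h | ⟨j, hj, h⟩)
      · exact ⟨n + 1, le_rfl, h⟩
      · exact ⟨j, by omega, h⟩
    · rintro ⟨j, hj, h⟩
      rcases Nat.lt_or_ge n j with h1 | h1
      · exact Or.inl (by rw [← h, show j = n + 1 by omega])
      · exact Or.inr ⟨j, h1, h⟩

theorem toEnd_mem_arc_iff (hT : G.IsTree) (r : Ray G) (x : V) :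
    toEnd r ∈ arc hT (r.toFun 0) x ↔ ∃ j, r.toFun j = x := by
  constructor
  · rintro ⟨s, hs, hs'⟩
    obtain ⟨m, n, hmn⟩ := ray_ext_of_equiv hs
    have h := hs' (m + 0)
    rw [hmn] at h
    obtain ⟨j, -, hj⟩ := (ray_mem_cone_iff hT r _ x).1 h
    exact ⟨j, hj⟩
  · rintro ⟨j, hj⟩
    refine ⟨⟨fun k => r.toFun (j + k), fun k => r.adj (j + k),
      fun k => r.nonbacktracking (j + k)⟩, Quotient.sound ⟨0, j, fun k => by simp⟩, fun k => ?_⟩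
    exact (ray_mem_cone_iff hT r _ x).2 ⟨j, by omega, hj⟩

theorem mem_arc_iff_onGeodesicRay (hT : G.IsTree) {o x : V} {ξ : Boundary G} :
    ξ ∈ arc hT o x ↔ OnGeodesicRay o ξ x := by
  constructor
  · intro h
    obtain ⟨r, rfl, rfl⟩ := exists_ray_from hT o ξ
    exact ⟨r, rfl, rfl, (toEnd_mem_arc_iff hT r x).1 h⟩
  · rintro ⟨r, rfl, rfl, h⟩
    exact (toEnd_mem_arc_iff hT r x).2 h

theorem arc_root (hT : G.IsTree) (o : V) : arc hT o o = Set.univ := by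
  refine Set.eq_univ_of_forall fun ξ => ?_
  obtain ⟨r, rfl, rfl⟩ := exists_ray_from hT o ξ
  exact (toEnd_mem_arc_iff hT r _).2 ⟨0, rfl⟩

theorem arc_subset_arc_pred (hT : G.IsTree) {o x : V} (hx : x ≠ o) :
    arc hT o x ⊆ arc hT o (pred hT o x) := by
  intro ξ h
  obtain ⟨r, rfl, rfl⟩ := exists_ray_from hT o ξ
  obtain ⟨j, rfl⟩ := (toEnd_mem_arc_iff hT r _).1 h
  obtain _ | j := j
  · exact absurd rfl hx
  · exact (toEnd_mem_arc_iff hT r _).2 ⟨j, (pred_ray hT r j).symm⟩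

/-- A ray eventually lies in `T_x` or eventually avoids `T_x`, according to its end. -/
theorem eventually_mem_cone_iff (hT : G.IsTree) (o x : V) (r : Ray G) :
    ∀ᶠ n in Filter.atTop, r.toFun n ∈ cone hT o x ↔ toEnd r ∈ arc hT o x := by
  obtain ⟨s, rfl, hs⟩ := exists_ray_from hT o (toEnd r)
  refine eventually_of_toEnd_eq (p := fun v => v ∈ cone hT (s.toFun 0) x ↔ _) hs.symm ?_
  rw [← hs, toEnd_mem_arc_iff]
  by_cases h : ∃ j, s.toFun j = x
  · obtain ⟨j, hj⟩ := h
    refine Filter.eventually_atTop.2 ⟨j, fun n hn => ?_⟩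
    rw [ray_mem_cone_iff]
    exact ⟨fun ⟨j, _, h⟩ => ⟨j, h⟩, fun _ => ⟨j, hn, hj⟩⟩
  · refine Filter.Eventually.of_forall fun n => ?_
    rw [ray_mem_cone_iff]
    exact ⟨fun ⟨j, _, h⟩ => ⟨j, h⟩, fun h' => absurd h' h⟩

/-- In a tree without finite branches, every cone contains a ray. -/
theorem exists_ray_in_cone (hT : G.IsTree) (o : V) (hf : ∀ x, (forward hT o x).Nonempty) (x : V) :
    ∃ r : Ray G, ∀ n, r.toFun n ∈ cone hT o x := by
  choose c hc using hf
  have hsucc : ∀ n, c^[n + 1] x ∈ forward hT o (c^[n] x) := fun n => by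
    rw [Function.iterate_succ_apply']
    exact hc _
  refine ⟨⟨fun n => c^[n] x, fun n => adj_of_forward hT (hsucc n), fun n h => ?_⟩, fun n => ?_⟩
  · have h1 := level_pred hT (hsucc n).1
    have h2 := level_pred hT (hsucc (n + 1)).1
    rw [(hsucc n).2] at h1
    rw [(hsucc (n + 1)).2, h] at h2
    omega
  · induction n with
    | zero => exact mem_cone_self hT o x
    | succ n ih =>
      refine (mem_cone_iff_pred hT (hsucc n).1).2 (Or.inr ?_)
      rwa [(hsucc n).2]

/-! ### Confluents -/

theorem confluent_root (hT : G.IsTree) (o : V) (ξ : Boundary G) : confluent hT o o ξ = o := by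
  unfold confluent
  rw [geod_self]
  simp

theorem confluent_of_mem (hT : G.IsTree) {o x : V} {ξ : Boundary G} (h : ξ ∈ arc hT o x) :
    confluent hT o x ξ = x := by
  classical
  unfold confluent
  rw [Nat.findGreatest_eq]
  · simp
  · rw [SimpleGraph.Walk.getVert_length]
    exact (mem_arc_iff_onGeodesicRay hT).1 h

theorem confluent_of_notMem (hT : G.IsTree) {o x : V} (hx : x ≠ o) {ξ : Boundary G}
    (h : ξ ∉ arc hT o x) : confluent hT o x ξ = confluent hT o (pred hT o x) ξ := by
  classical
  have hv : ∀ i ≤ (geod hT o (pred hT o x)).length,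
      (geod hT o x).getVert i = (geod hT o (pred hT o x)).getVert i := by
    intro i hi
    rw [geod_eq_concat_pred hT hx, SimpleGraph.Walk.concat_eq_append,
      SimpleGraph.Walk.getVert_append]
    split_ifs with h1
    · rfl
    · rw [show i = (geod hT o (pred hT o x)).length by omega]
      simp
  have hlen : (geod hT o x).length = (geod hT o (pred hT o x)).length + 1 := level_pred hT hx
  have hlast : ¬ OnGeodesicRay o ξ
      ((geod hT o x).getVert ((geod hT o (pred hT o x)).length + 1)) := by
    rw [← hlen, SimpleGraph.Walk.getVert_length, ← mem_arc_iff_onGeodesicRay hT]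
    exact h
  have hcongr : ∀ N ≤ (geod hT o (pred hT o x)).length,
      Nat.findGreatest (fun i => OnGeodesicRay o ξ ((geod hT o x).getVert i)) N =
      Nat.findGreatest (fun i => OnGeodesicRay o ξ ((geod hT o (pred hT o x)).getVert i)) N := by
    intro N
    induction N with
    | zero => simp
    | succ N ih =>
      intro hN
      simp only [Nat.findGreatest_succ, hv _ hN, ih (by omega)]
  unfold confluent
  rw [hlen, Nat.findGreatest_of_not hlast, hcongr _ le_rfl]
  exact hv _ (Nat.findGreatest_le _)

theorem confluent_notMem_cone (hT : G.IsTree) {o x : V} (hx : x ≠ o) (ξ : Boundary G) :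
    confluent hT o (pred hT o x) ξ ∉ cone hT o x := by
  classical
  intro h
  -- The confluent lies on `π(o,x⁻)`, so in `T_x` it would force `x⁻ ∈ T_x`.
  have hmem : confluent hT o (pred hT o x) ξ ∈ (geod hT o (pred hT o x)).support :=
    SimpleGraph.Walk.getVert_mem_support _ _
  refine pred_notMem_cone hT hx ?_
  have h' : x ∈ (geod hT o (confluent hT o (pred hT o x) ξ)).support := h
  rw [← eq_geod hT ((geod_isPath hT o _).takeUntil hmem)] at h'
  exact SimpleGraph.Walk.support_takeUntil_subset_support _ hmem h'

/-! ### Locally constant functions and distributions -/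

/-- The locally constant function `f` on `T` has trace `φ` on `∂T`. -/
def HasTrace (G : SimpleGraph V) (f : V → ℂ) (φ : Boundary G → ℂ) : Prop :=
  LocallyConst G f ∧ ∀ r : Ray G, ∀ᶠ n in Filter.atTop, f (r.toFun n) = φ (toEnd r)

theorem mem_boundaryLocConst_iff {φ : Boundary G → ℂ} :
    φ ∈ boundaryLocConst G ↔ ∃ f, HasTrace G f φ := Iff.rfl

theorem HasTrace.add {f g : V → ℂ} {φ ψ : Boundary G → ℂ} (hf : HasTrace G f φ)
    (hg : HasTrace G g ψ) : HasTrace G (f + g) (φ + ψ) := by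
  refine ⟨(hf.1.union hg.1).subset ?_, fun r => ?_⟩
  · rintro ⟨a, b⟩ ⟨hab, hne⟩
    by_contra hcon
    simp only [Set.mem_union, Set.mem_ofPred_eq, not_or, not_and, not_not] at hcon
    apply hne
    simp only [Pi.add_apply]
    rw [hcon.1 hab, hcon.2 hab]
  · filter_upwards [hf.2 r, hg.2 r] with n h1 h2
    simp [h1, h2]

theorem HasTrace.smul (c : ℂ) {f : V → ℂ} {φ : Boundary G → ℂ} (hf : HasTrace G f φ) :
    HasTrace G (c • f) (c • φ) := by
  refine ⟨hf.1.subset ?_, fun r => ?_⟩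
  · rintro ⟨a, b⟩ ⟨hab, hne⟩
    refine ⟨hab, fun h => hne ?_⟩
    simp only [Pi.smul_apply]
    rw [h]
  · filter_upwards [hf.2 r] with n h1
    simp [h1]

open Classical in
/-- The increment of `f` along the edge from `x⁻` to `x`; at the root it is `f(o)`, as if `f`
vanished at a predecessor of the root. -/
noncomputable def increment (hT : G.IsTree) (o : V) (f : V → ℂ) (x : V) : ℂ :=
  if x = o then f x else f x - f (pred hT o x)

theorem increment_root (hT : G.IsTree) (o : V) (f : V → ℂ) : increment hT o f o = f o := by
  simp [increment]

theorem increment_of_ne (hT : G.IsTree) {o x : V} (hx : x ≠ o) (f : V → ℂ) :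
    increment hT o f x = f x - f (pred hT o x) := by
  simp [increment, hx]

theorem increment_add (hT : G.IsTree) (o : V) (f g : V → ℂ) (x : V) :
    increment hT o (f + g) x = increment hT o f x + increment hT o g x := by
  unfold increment
  split_ifs
  · rfl
  · simp only [Pi.add_apply]
    ring

theorem increment_smul (hT : G.IsTree) (o : V) (c : ℂ) (f : V → ℂ) (x : V) :
    increment hT o (c • f) x = c * increment hT o f x := by
  unfold increment
  split_ifs
  · rfl
  · simp only [Pi.smul_apply, smul_eq_mul]
    ring

theorem LocallyConst.finite_increment (hT : G.IsTree) (o : V) {f : V → ℂ}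
    (hf : LocallyConst G f) : (Function.support (increment hT o f)).Finite := by
  refine ((Set.finite_singleton o).union (hf.image Prod.snd)).subset fun x hx => ?_
  by_cases hxo : x = o
  · exact Or.inl hxo
  · refine Or.inr ⟨(pred hT o x, x), ⟨adj_pred hT hxo, fun h => hx ?_⟩, rfl⟩
    simp only at h
    rw [increment_of_ne hT hxo, h, sub_self]

/-- The indicator function of `T_x` jumps only along the edge from `x⁻` to `x`. -/
theorem increment_cone (hT : G.IsTree) (o x w : V) :
    increment hT o ((cone hT o x).indicator fun _ => 1) w = Set.indicator {x} (fun _ => 1) w := by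
  classical
  by_cases hw : w = o
  · subst hw
    simp [increment_root, Set.indicator_apply, root_mem_cone_iff]
  · rw [increment_of_ne hT hw]
    by_cases hwx : w = x
    · subst hwx
      simp [mem_cone_self, pred_notMem_cone hT hw]
    · simp [Set.indicator_apply, mem_cone_iff_pred hT hw, hwx]

theorem eq_sum_increment (hT : G.IsTree) (o : V) (f : V → ℂ) {S : Finset V}
    (hS : ∀ x, increment hT o f x ≠ 0 → x ∈ S) (w : V) :
    f w = ∑ x ∈ S, increment hT o f x * (cone hT o x).indicator (fun _ => 1) w := by
  classical
  have key : ∀ w, ∑ x ∈ S, increment hT o f x * Set.indicator {x} (fun _ => (1 : ℂ)) w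
      = increment hT o f w := by
    intro w
    simp only [Set.indicator_apply, Set.mem_singleton_iff, mul_ite, mul_one, mul_zero]
    rw [Finset.sum_ite_eq]
    split_ifs with h
    · rfl
    · by_contra h0
      exact h (hS w (Ne.symm h0))
  induction w using pred_induction hT o with
  | root =>
    rw [← increment_root hT o f, ← key o]
    refine Finset.sum_congr rfl fun x _ => ?_
    rw [← increment_cone hT o x o, increment_root]
  | step w hw ih =>
    have h1 := key w
    simp only [← increment_cone hT o, increment_of_ne hT hw, mul_sub, Finset.sum_sub_distrib] at h1
    rw [← ih] at h1
    exact (sub_left_inj.1 h1).symm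

theorem indicator_cone_hasTrace (hT : G.IsTree) (o x : V) :
    HasTrace G ((cone hT o x).indicator fun _ => 1) ((arc hT o x).indicator fun _ => 1) := by
  classical
  refine ⟨?_, fun r => ?_⟩
  · refine (Set.toFinite {(x, pred hT o x), (pred hT o x, x)}).subset ?_
    rintro ⟨a, b⟩ ⟨hab, hne⟩
    simp only at hab hne
    by_cases ha : a ∈ cone hT o x <;> by_cases hb : b ∈ cone hT o x
    · simp [ha, hb] at hne
    · obtain ⟨h1, h2⟩ := cone_adj hT hab ha hb
      simp [h1, h2]
    · obtain ⟨h1, h2⟩ := cone_adj hT hab.symm hb ha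
      simp [h1, h2]
    · simp [ha, hb] at hne
  · filter_upwards [eventually_mem_cone_iff hT o x r] with n hn
    simp only [Set.indicator_apply, hn]

/-- The indicator functions of the boundary arcs span `∂𝒱`. -/
theorem HasTrace.eq_sum (hT : G.IsTree) (o : V) {f : V → ℂ} {φ : Boundary G → ℂ}
    (hf : HasTrace G f φ) {S : Finset V} (hS : ∀ x, increment hT o f x ≠ 0 → x ∈ S) :
    φ = ∑ x ∈ S, increment hT o f x • (arc hT o x).indicator (fun _ => (1 : ℂ)) := by
  funext ξ
  obtain ⟨r, rfl⟩ : ∃ r : Ray G, toEnd r = ξ := Quotient.exists_rep ξ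
  have h1 : ∀ᶠ n in Filter.atTop, ∀ x ∈ S,
      (cone hT o x).indicator (fun _ => (1 : ℂ)) (r.toFun n)
        = (arc hT o x).indicator (fun _ => (1 : ℂ)) (toEnd r) :=
    (Filter.eventually_all_finset S).2 fun x _ => (indicator_cone_hasTrace hT o x).2 r
  obtain ⟨n, h2, h3⟩ := ((hf.2 r).and h1).exists
  rw [← h2, eq_sum_increment hT o f hS]
  simp only [Finset.sum_apply, Pi.smul_apply, smul_eq_mul]
  exact Finset.sum_congr rfl fun x hx => by rw [h3 x hx]

/-- A distribution is determined by its values on boundary arcs. -/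
theorem distribution_ext (hT : G.IsTree) (o : V) {ν ν' : Distribution G}
    (h : ∀ x, arcMass hT o ν x = arcMass hT o ν' x) : ν = ν' := by
  ext ⟨φ, hφ⟩
  obtain ⟨f, hf⟩ := mem_boundaryLocConst_iff.1 hφ
  have hfin := hf.1.finite_increment hT o
  have hsum : (⟨φ, hφ⟩ : boundaryLocConst G) = ∑ x ∈ hfin.toFinset,
      increment hT o f x • ⟨(arc hT o x).indicator (fun _ => 1), indicator_arc_mem hT o x⟩ := by
    apply Subtype.ext
    refine (hf.eq_sum hT o (S := hfin.toFinset) fun x hx => hfin.mem_toFinset.2 hx).trans ?_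
    simp
  rw [hsum, map_sum, map_sum]
  refine Finset.sum_congr rfl fun x _ => ?_
  rw [map_smul, map_smul]
  exact congrArg _ (h x)

/-- A locally constant function with vanishing trace has finite support: if `f(x) ≠ 0`, then `f`
changes its value somewhere in `T_x`, so `x` is an ancestor of one of finitely many vertices. -/
theorem HasTrace.finite_support (hT : G.IsTree) (o : V) (hfw : ∀ x, (forward hT o x).Nonempty)
    {f : V → ℂ} (hf : HasTrace G f 0) : (Function.support f).Finite := by
  have hfin := hf.1.finite_increment hT o
  refine (hfin.biUnion fun w _ => finite_ancestors hT o w).subset fun x hx => ?_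
  by_contra hcon
  simp only [Set.mem_iUnion, not_exists] at hcon
  have hinc : ∀ w ∈ cone hT o x, increment hT o f w = 0 := fun w hw => by
    by_contra h0
    exact hcon w h0 hw
  have hconst : ∀ w, w ∈ cone hT o x → f w = f x := by
    intro w
    induction w using pred_induction hT o with
    | root => exact fun h => congrArg f ((root_mem_cone_iff hT).1 h)
    | step w hw ih =>
      intro hmem
      rcases (mem_cone_iff_pred hT hw).1 hmem with h | h
      · rw [h]
      · have h1 := hinc w hmem
        rw [increment_of_ne hT hw, ih h] at h1
        exact sub_eq_zero.1 h1
  obtain ⟨r, hr⟩ := exists_ray_in_cone hT o hfw x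
  obtain ⟨n, hn⟩ := (hf.2 r).exists
  rw [hconst _ (hr n)] at hn
  exact hx hn

/-- Summation by parts: a function with finite support pairs to zero with an additive family of
masses. -/
theorem tsum_increment_of_finite_support (hT : G.IsTree) (o : V) {μ : V → ℂ}
    (hμ : ∀ x, HasSum (fun y : forward hT o x => μ y) (μ x)) {f : V → ℂ}
    (hf : (Function.support f).Finite) : ∑' x, increment hT o f x * μ x = 0 := by
  classical
  set S := hf.toFinset with hS
  have hmem : ∀ x, x ∉ S → f x = 0 := fun x hx => by
    by_contra h0
    exact hx (hf.mem_toFinset.2 h0)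
  have h1 : HasSum (fun w => f w * μ w) (∑ x ∈ S, f x * μ x) :=
    hasSum_sum_of_ne_finset_zero fun w hw => by rw [hmem w hw, zero_mul]
  have h2 : HasSum (fun w => ∑ x ∈ S, f x * (forward hT o x).indicator μ w)
      (∑ x ∈ S, f x * μ x) :=
    hasSum_sum fun x _ => (hasSum_subtype_iff_indicator.1 (hμ x)).mul_left (f x)
  have h3 := h1.sub h2
  rw [sub_self] at h3
  rw [← h3.tsum_eq]
  refine tsum_congr fun w => ?_
  by_cases hw : w = o
  · subst hw
    have : ∀ x, (forward hT w x).indicator μ w = 0 := fun x =>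
      Set.indicator_of_notMem (fun h => h.1 rfl) _
    simp [this, increment_root]
  · have : ∀ x, f x * (forward hT o x).indicator μ w =
        if pred hT o w = x then f x * μ w else 0 := by
      intro x
      by_cases hx : pred hT o w = x <;> simp [forward, hw, hx]
    simp only [this, Finset.sum_ite_eq]
    rw [increment_of_ne hT hw]
    split_ifs with h
    · ring
    · rw [hmem _ h]
      ring

theorem HasTrace.summable (hT : G.IsTree) (o : V) (μ : V → ℂ) {f : V → ℂ} {φ : Boundary G → ℂ}
    (hf : HasTrace G f φ) : Summable fun x => increment hT o f x * μ x :=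
  summable_of_hasFiniteSupport ((hf.1.finite_increment hT o).subset fun x hx h0 =>
    hx (by simp only [h0, zero_mul]))

theorem HasTrace.tsum_eq (hT : G.IsTree) (o : V) (hfw : ∀ x, (forward hT o x).Nonempty)
    {μ : V → ℂ} (hμ : ∀ x, HasSum (fun y : forward hT o x => μ y) (μ x)) {f g : V → ℂ}
    {φ : Boundary G → ℂ} (hf : HasTrace G f φ) (hg : HasTrace G g φ) :
    ∑' x, increment hT o f x * μ x = ∑' x, increment hT o g x * μ x := by
  have h := hf.add (hg.smul (-1))
  have h0 : φ + (-1 : ℂ) • φ = 0 := by simp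
  have h1 := tsum_increment_of_finite_support hT o hμ ((h0 ▸ h).finite_support hT o hfw)
  simp only [increment_add, increment_smul] at h1
  rw [← sub_eq_zero, ← (hf.summable hT o μ).tsum_sub (hg.summable hT o μ), ← h1]
  exact tsum_congr fun x => by ring

/-- A family of masses that is additive over forward neighbours is the family of arc masses of a
distribution. -/
theorem exists_distribution (hT : G.IsTree) (o : V) (hfw : ∀ x, (forward hT o x).Nonempty)
    {μ : V → ℂ} (hμ : ∀ x, HasSum (fun y : forward hT o x => μ y) (μ x)) :
    ∃ ν : Distribution G, ∀ x, arcMass hT o ν x = μ x := by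
  choose f hf using fun φ : boundaryLocConst G => mem_boundaryLocConst_iff.1 φ.2
  refine ⟨{ toFun := fun φ => ∑' x, increment hT o (f φ) x * μ x
            map_add' := fun φ ψ => ?_
            map_smul' := fun c φ => ?_ }, fun x => ?_⟩
  · rw [(hf (φ + ψ)).tsum_eq hT o hfw hμ ((hf φ).add (hf ψ)),
      ← ((hf φ).summable hT o μ).tsum_add ((hf ψ).summable hT o μ)]
    exact tsum_congr fun x => by rw [increment_add, add_mul]
  · rw [(hf (c • φ)).tsum_eq hT o hfw hμ ((hf φ).smul c), RingHom.id_apply, smul_eq_mul,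
      ← tsum_mul_left]
    exact tsum_congr fun x => by rw [increment_smul, mul_assoc]
  · change ∑' w, increment hT o (f _) w * μ w = _
    rw [(hf _).tsum_eq hT o hfw hμ (indicator_cone_hasTrace hT o x), tsum_eq_single x]
    · simp [increment_cone]
    · intro w hw
      simp [increment_cone, hw]

theorem isStrong_of_hasSum (hT : G.IsTree) (o : V) {ν : Distribution G}
    (h : ∀ x, HasSum (fun y : forward hT o x => arcMass hT o ν y) (arcMass hT o ν x)) :
    IsStrong hT o ν := fun x => ⟨(h x).summable.norm, (h x).tsum_eq.symm⟩

/-! ### Abstract Green kernels -/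

open Classical in
/-- The properties of the Green function at `lam` that the representation theorem depends on: the
resolvent equation, nonvanishing on the diagonal, and multiplicativity along cut points. The latter
says that `Gr(x,y) Gr(w,w) = Gr(x,w) Gr(w,y)` if all edges that leave some set `C` containing `x`
but neither `w` nor `y` end in `w`. -/
structure IsGreenKernel (W : NNWalk G) (lam : ℂ) (Gr : V → V → ℂ) : Prop where
  resolvent_eq : ∀ x y, HasSum (fun w => (W.p x w : ℂ) * Gr w y)
    (lam * Gr x y - if x = y then 1 else 0)
  diag_ne_zero : ∀ x, Gr x x ≠ 0
  cut : ∀ (C : Set V) (w : V), w ∉ C → (∀ z ∈ C, ∀ z', G.Adj z z' → z' ∈ C ∨ z' = w) →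
    ∀ x ∈ C, ∀ y ∉ C, Gr x y * Gr w w = Gr x w * Gr w y

theorem hasSum_of_eq {ι M : Type*} [AddCommMonoid M] [TopologicalSpace M] {f g : ι → M}
    {a b : M} (hf : HasSum f a) (hfg : ∀ i, g i = f i) (hab : b = a) : HasSum g b := by
  rwa [funext hfg, hab]

namespace NNWalk

theorem p_eq_zero (W : NNWalk G) {x y : V} (h : ¬ G.Adj x y) : W.p x y = 0 :=
  le_antisymm (not_lt.1 fun h' => h ((W.pos_iff _ _).1 h')) (W.nonneg _ _)

theorem p_ne_zero (W : NNWalk G) {x y : V} (h : G.Adj x y) : (W.p x y : ℂ) ≠ 0 :=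
  Complex.ofReal_ne_zero.2 ((W.pos_iff _ _).2 h).ne'

theorem exists_adj (W : NNWalk G) (x : V) : ∃ y, G.Adj x y := by
  by_contra hcon
  push Not at hcon
  have h := W.hasSum x
  rw [show W.p x = fun _ => 0 from funext fun y => W.p_eq_zero (hcon y)] at h
  exact zero_ne_one (hasSum_zero.unique h)

/-- Every vertex has a forward neighbour if there are no vertices of degree `1`. -/
theorem forward_nonempty (W : NNWalk G) (hT : G.IsTree)
    (hleaf : ∀ x, (G.neighborSet x).encard ≠ 1) (o x : V) : (forward hT o x).Nonempty := by
  by_contra hcon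
  rw [Set.not_nonempty_iff_eq_empty] at hcon
  have hadj : ∀ y, G.Adj x y → x ≠ o ∧ y = pred hT o x := fun y hy =>
    ((adj_iff hT).1 hy).resolve_left (by simp [hcon])
  obtain ⟨y, hy⟩ := W.exists_adj x
  refine hleaf x (Set.encard_eq_one.2 ⟨y, Set.eq_singleton_iff_unique_mem.2 ⟨hy, fun z hz => ?_⟩⟩)
  rw [(hadj z hz).2, (hadj y hy).2]

end NNWalk

namespace IsGreenKernel

variable {W : NNWalk G} {lam : ℂ} {Gr : V → V → ℂ}

theorem mul_of_mem_cone (hK : IsGreenKernel W lam Gr) (hT : G.IsTree) {x y w : V}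
    (h : x ∈ cone hT y w) : Gr x y * Gr w w = Gr x w * Gr w y := by
  by_cases hxw : x = w
  · rw [hxw, mul_comm]
  refine hK.cut (cone hT y w \ {w}) w (fun h => h.2 rfl) ?_ x ⟨h, hxw⟩ y ?_
  · rintro z ⟨hz, hzw⟩ z' hzz'
    by_cases h1 : z' = w
    · exact Or.inr h1
    · refine Or.inl ⟨?_, h1⟩
      by_contra h2
      exact hzw (cone_adj hT hzz' hz h2).1
  · exact fun h => h.2 ((root_mem_cone_iff hT).1 h.1)

theorem mul_pred (hK : IsGreenKernel W lam Gr) (hT : G.IsTree) (x y : V) :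
    Gr x y * Gr (pred hT y x) (pred hT y x) = Gr x (pred hT y x) * Gr (pred hT y x) y :=
  hK.mul_of_mem_cone hT (SimpleGraph.Walk.getVert_mem_support _ _)

theorem root_mul_pred (hK : IsGreenKernel W lam Gr) (hT : G.IsTree) (o x : V) :
    Gr o x * Gr (pred hT o x) (pred hT o x) = Gr o (pred hT o x) * Gr (pred hT o x) x := by
  refine hK.mul_of_mem_cone hT ?_
  change pred hT o x ∈ (geod hT x o).support
  rw [← eq_geod hT (geod_isPath hT o x).reverse, SimpleGraph.Walk.support_reverse,
    List.mem_reverse]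
  exact SimpleGraph.Walk.getVert_mem_support _ _

theorem mul_of_adj (hK : IsGreenKernel W lam Gr) (hT : G.IsTree) {x y w : V} (hxy : G.Adj x y)
    (hxw : G.Adj x w) (hw : w ≠ y) : Gr w y * Gr x x = Gr w x * Gr x y := by
  refine hK.mul_of_mem_cone hT ?_
  rcases adj_cases hT y hxw with h | h
  · refine (mem_cone_iff_pred hT hw).2 (Or.inr ?_)
    rw [h.2]
    exact mem_cone_self hT y x
  · -- The only neighbour of `x` on `π(y,x)` is `y` itself.
    exfalso
    apply hw
    rw [← h.2]
    rcases adj_cases hT y hxy with h1 | h1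
    · exact absurd rfl h1.1
    · exact h1.2

theorem ne_zero_of_adj (hK : IsGreenKernel W lam Gr) (hT : G.IsTree) {x y : V}
    (hxy : G.Adj x y) : Gr x y ≠ 0 := by
  intro h0
  have h1 := hK.resolvent_eq x y
  rw [h0, if_neg hxy.ne, mul_zero, sub_zero] at h1
  have h2 : HasSum (fun w => (W.p x w : ℂ) * Gr w y) ((W.p x y : ℂ) * Gr y y) := by
    refine hasSum_single y fun w hw => ?_
    by_cases hxw : G.Adj x w
    · have h3 := hK.mul_of_adj hT hxy hxw hw
      rw [h0, mul_zero] at h3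
      rw [(mul_eq_zero.1 h3).resolve_right (hK.diag_ne_zero x), mul_zero]
    · rw [W.p_eq_zero hxw, Complex.ofReal_zero, zero_mul]
  exact mul_ne_zero (W.p_ne_zero hxy) (hK.diag_ne_zero y) (h2.unique h1)

theorem ne_zero (hK : IsGreenKernel W lam Gr) (hT : G.IsTree) (x y : V) : Gr x y ≠ 0 := by
  induction x using pred_induction hT y with
  | root => exact hK.diag_ne_zero y
  | step x hx ih =>
    intro h0
    have h := hK.mul_pred hT x y
    rw [h0, zero_mul] at h
    exact mul_ne_zero (hK.ne_zero_of_adj hT (adj_pred hT hx).symm) ih h.symm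

/-- The resolvent equations at `(x,y)` and `(x,x)` differ, after the second is scaled by
`Gr(x,y)/Gr(x,x)`, by the single summand at `y`. -/
theorem mul_one_sub (hK : IsGreenKernel W lam Gr) (hT : G.IsTree) {x y : V} (hxy : G.Adj x y) :
    (W.p x y : ℂ) * Gr x x * (1 - greenWeight Gr x y * greenWeight Gr y x)
      = greenWeight Gr x y := by
  have hx := hK.diag_ne_zero x
  have hy := hK.diag_ne_zero y
  have h1 := (hK.resolvent_eq x y).sub ((hK.resolvent_eq x x).mul_left (Gr x y / Gr x x))
  rw [if_neg hxy.ne, if_pos rfl] at h1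
  have h2 := h1.unique (hasSum_single y fun w hw => by
    by_cases hxw : G.Adj x w
    · have h3 := hK.mul_of_adj hT hxy hxw hw
      field_simp
      linear_combination (W.p x w : ℂ) * h3
    · simp [W.p_eq_zero hxw])
  unfold greenWeight
  field_simp at h2 ⊢
  linear_combination -h2

theorem one_sub_ne_zero (hK : IsGreenKernel W lam Gr) (hT : G.IsTree) {x y : V}
    (hxy : G.Adj x y) : 1 - greenWeight Gr x y * greenWeight Gr y x ≠ 0 := by
  intro h0
  have h := hK.mul_one_sub hT hxy
  rw [h0, mul_zero] at h
  exact div_ne_zero (hK.ne_zero hT x y) (hK.diag_ne_zero y) h.symm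

end IsGreenKernel

/-! ### Arc masses of harmonic functions -/

open Classical in
/-- The mass that the distribution representing `h` gives to the boundary arc `∂T_x`. -/
noncomputable def harmonicMass (hT : G.IsTree) (o : V) (Gr : V → V → ℂ) (h : V → ℂ) (x : V) : ℂ :=
  if x = o then h o else
    greenWeight Gr o x * (h x - greenWeight Gr x (pred hT o x) * h (pred hT o x)) /
      (1 - greenWeight Gr (pred hT o x) x * greenWeight Gr x (pred hT o x))

namespace IsGreenKernel

variable {W : NNWalk G} {lam : ℂ} {Gr : V → V → ℂ}

theorem harmonicMass_forward (hK : IsGreenKernel W lam Gr) (hT : G.IsTree) {o x y : V}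
    (hy : y ∈ forward hT o x) (h : V → ℂ) :
    harmonicMass hT o Gr h y = greenWeight Gr o x * Gr x x *
      ((W.p x y : ℂ) * (h y - greenWeight Gr y x * h x)) := by
  obtain ⟨hyo, rfl⟩ := hy
  have h1 := hK.mul_one_sub hT (adj_pred hT hyo)
  have h2 := hK.one_sub_ne_zero hT (adj_pred hT hyo)
  have h3 : greenWeight Gr o y =
      greenWeight Gr o (pred hT o y) * greenWeight Gr (pred hT o y) y := by
    have h4 := hK.root_mul_pred hT o y
    have h5 := hK.diag_ne_zero y
    have h6 := hK.diag_ne_zero (pred hT o y)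
    unfold greenWeight
    field_simp
    linear_combination h4
  rw [harmonicMass, if_neg hyo, div_eq_iff h2, h3]
  linear_combination -greenWeight Gr o (pred hT o y) *
    (h y - greenWeight Gr y (pred hT o y) * h (pred hT o y)) * h1

/-- The masses of a harmonic function are additive over forward neighbours. -/
theorem hasSum_harmonicMass (hK : IsGreenKernel W lam Gr) (hT : G.IsTree) (o : V) {h : V → ℂ}
    (hh : W.IsHarmonic lam h) (x : V) :
    HasSum (fun y : forward hT o x => harmonicMass hT o Gr h y) (harmonicMass hT o Gr h x) := by
  classical
  have hx := hK.diag_ne_zero x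
  set t : V → ℂ := fun y => (W.p x y : ℂ) * (h y - greenWeight Gr y x * h x) with ht
  have h1 : HasSum (fun y => (W.p x y : ℂ) * h y) (lam * h x) := by
    rw [← (hh x).2]
    exact (hh x).1.of_norm.hasSum
  have h2 : HasSum t (h x / Gr x x) := by
    have h3 := h1.sub ((hK.resolvent_eq x x).mul_right (h x / Gr x x))
    rw [if_pos rfl] at h3
    refine hasSum_of_eq h3 (fun y => ?_) ?_
    · simp only [ht, greenWeight]
      ring
    · field_simp
      ring
  -- The terms over forward neighbours are all terms except the one at the predecessor.
  suffices hsum : HasSum ((forward hT o x).indicator t)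
      (h x / Gr x x - if x = o then 0 else t (pred hT o x)) by
    have h4 := (hasSum_subtype_iff_indicator.2 hsum).mul_left (greenWeight Gr o x * Gr x x)
    refine hasSum_of_eq h4 (fun y => ?_) ?_
    · exact hK.harmonicMass_forward hT y.2 h
    · by_cases hxo : x = o
      · subst hxo
        simp only [harmonicMass, if_true, greenWeight]
        field_simp
        ring
      · rw [harmonicMass, if_neg hxo, if_neg hxo,
          div_eq_iff (hK.one_sub_ne_zero hT (adj_pred hT hxo))]
        have h5 := hK.mul_one_sub hT (adj_pred hT hxo).symm
        simp only [ht]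
        have h6 : Gr x x * (h x / Gr x x) = h x := by field_simp
        linear_combination (greenWeight Gr o x * (greenWeight Gr (pred hT o x) x * h x
          - h (pred hT o x))) * -h5 - greenWeight Gr o x *
          (1 - greenWeight Gr (pred hT o x) x * greenWeight Gr x (pred hT o x)) * h6
  by_cases hxo : x = o
  · rw [if_pos hxo, sub_zero]
    refine hasSum_of_eq h2 (fun y => ?_) rfl
    by_cases hy : y ∈ forward hT o x
    · rw [Set.indicator_of_mem hy]
    · have : ¬ G.Adj x y := fun h => ((adj_iff hT).1 h).elim hy fun h' => h'.1 hxo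
      rw [Set.indicator_of_notMem hy]
      simp [ht, W.p_eq_zero this]
  · rw [if_neg hxo]
    refine hasSum_of_eq (h2.sub (hasSum_ite_eq (pred hT o x) (t (pred hT o x)))) (fun y => ?_) rfl
    by_cases hyx : y = pred hT o x
    · subst hyx
      simp [pred_notMem_forward hT hxo]
    · by_cases hy : y ∈ forward hT o x
      · simp [hy, hyx]
      · have : ¬ G.Adj x y := fun h => ((adj_iff hT).1 h).elim hy fun h' => hyx h'.2
        simp [hy, hyx, ht, W.p_eq_zero this]

/-! ### Integrals of the Martin kernel -/

theorem martinKernel_root (hK : IsGreenKernel W lam Gr) (hT : G.IsTree) (o : V) :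
    martinKernel hT o Gr o = (arc hT o o).indicator fun _ => 1 := by
  funext ξ
  simp [martinKernel, confluent_root, arc_root, hK.diag_ne_zero o]

/-- The Martin kernel at `x` is that at `x⁻`, scaled by `F(x,x⁻)`, plus a multiple of the indicator
of `∂T_x`: outside `∂T_x`, the confluents of `x` and of `x⁻` agree, and `x⁻` separates them from
`x`. -/
theorem martinKernel_eq (hK : IsGreenKernel W lam Gr) (hT : G.IsTree) {o x : V} (hx : x ≠ o) :
    martinKernel hT o Gr x
      = greenWeight Gr x (pred hT o x) • martinKernel hT o Gr (pred hT o x)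
        + ((1 - greenWeight Gr (pred hT o x) x * greenWeight Gr x (pred hT o x))
            / greenWeight Gr o x) • (arc hT o x).indicator fun _ => 1 := by
  funext ξ
  have h1 := hK.diag_ne_zero x
  have h2 := hK.diag_ne_zero (pred hT o x)
  simp only [martinKernel, Pi.add_apply, Pi.smul_apply, smul_eq_mul, greenWeight]
  by_cases hξ : ξ ∈ arc hT o x
  · rw [confluent_of_mem hT hξ, confluent_of_mem hT (arc_subset_arc_pred hT hx hξ),
      Set.indicator_of_mem hξ]
    have h3 := hK.ne_zero hT o x
    have h4 := hK.ne_zero hT o (pred hT o x)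
    have h5 := hK.root_mul_pred hT o x
    field_simp
    linear_combination -Gr x (pred hT o x) * h5
  · rw [confluent_of_notMem hT hx hξ, Set.indicator_of_notMem hξ]
    have h3 := confluent_notMem_cone hT hx ξ
    generalize confluent hT o (pred hT o x) ξ = v at h3
    have h4 := hK.ne_zero hT o v
    have h5 := hK.cut (cone hT o x) (pred hT o x) (pred_notMem_cone hT hx) (fun z hz z' hzz' => by
      by_cases h : z' ∈ cone hT o x
      · exact Or.inl h
      · exact Or.inr (cone_adj hT hzz' hz h).2) x (mem_cone_self hT o x) v h3
    field_simp
    linear_combination h5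

theorem martinKernel_mem (hK : IsGreenKernel W lam Gr) (hT : G.IsTree) (o x : V) :
    martinKernel hT o Gr x ∈ boundaryLocConst G := by
  induction x using pred_induction hT o with
  | root => rw [hK.martinKernel_root hT]; exact indicator_arc_mem hT o o
  | step x hx ih =>
    rw [hK.martinKernel_eq hT hx]
    exact Submodule.add_mem _ (Submodule.smul_mem _ _ ih)
      (Submodule.smul_mem _ _ (indicator_arc_mem hT o x))

theorem dual_martinKernel_root (hK : IsGreenKernel W lam Gr) (hT : G.IsTree) (o : V)
    (ν : Distribution G) :
    ν ⟨martinKernel hT o Gr o, hK.martinKernel_mem hT o o⟩ = arcMass hT o ν o :=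
  congrArg ν (Subtype.ext (hK.martinKernel_root hT o))

theorem dual_martinKernel_eq (hK : IsGreenKernel W lam Gr) (hT : G.IsTree) {o x : V} (hx : x ≠ o)
    (ν : Distribution G) :
    ν ⟨martinKernel hT o Gr x, hK.martinKernel_mem hT o x⟩
      = greenWeight Gr x (pred hT o x) *
          ν ⟨martinKernel hT o Gr (pred hT o x), hK.martinKernel_mem hT o _⟩
        + (1 - greenWeight Gr (pred hT o x) x * greenWeight Gr x (pred hT o x))
            / greenWeight Gr o x * arcMass hT o ν x := by
  rw [arcMass, ← smul_eq_mul, ← smul_eq_mul, ← map_smul, ← map_smul, ← map_add]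
  exact congrArg ν (Subtype.ext (hK.martinKernel_eq hT hx))

/-- By the recursion for the Martin kernel, the integrals `∫ K(x,·) dν` and the arc masses of `ν`
determine each other. -/
theorem represents_iff (hK : IsGreenKernel W lam Gr) (hT : G.IsTree) (o : V) (h : V → ℂ)
    (ν : Distribution G) :
    (∀ x, HasBoundaryIntegral ν (martinKernel hT o Gr x) (h x)) ↔
      ∀ x, arcMass hT o ν x = harmonicMass hT o Gr h x := by
  have hF : ∀ x, greenWeight Gr o x ≠ 0 := fun x =>
    div_ne_zero (hK.ne_zero hT o x) (hK.diag_ne_zero x)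
  constructor
  · intro hν
    have hval : ∀ x, ν ⟨martinKernel hT o Gr x, hK.martinKernel_mem hT o x⟩ = h x := fun x =>
      (hν x).choose_spec
    intro x
    by_cases hx : x = o
    · subst hx
      rw [harmonicMass, if_pos rfl, ← hval, hK.dual_martinKernel_root]
    · have h1 := hK.dual_martinKernel_eq hT hx ν
      have h2 := hF x
      rw [hval, hval] at h1
      rw [harmonicMass, if_neg hx, eq_div_iff (hK.one_sub_ne_zero hT (adj_pred hT hx)), h1]
      field_simp
      ring
  · refine fun hν x => ⟨hK.martinKernel_mem hT o x, ?_⟩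
    induction x using pred_induction hT o with
    | root => rw [hK.dual_martinKernel_root, hν, harmonicMass, if_pos rfl]
    | step x hx ih =>
      have h1 := hF x
      have h2 := hK.one_sub_ne_zero hT (adj_pred hT hx)
      rw [hK.dual_martinKernel_eq hT hx, ih, hν, harmonicMass, if_neg hx]
      generalize 1 - greenWeight Gr (pred hT o x) x * greenWeight Gr x (pred hT o x) = d at h2
      field_simp
      ring

end IsGreenKernel

namespace NNWalk

variable (W : NNWalk G)

/-! ### The Green function on the resolvent set -/

open Classical in
theorem delta_apply (hT : G.IsTree) (o y x : V) :
    (W.delta hT o y : V → ℂ) x = if x = y then 1 else 0 := by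
  have h : (W.delta hT o y : V → ℂ) = Set.indicator {y} fun _ => 1 :=
    W.eq_of_ae_eq hT MeasureTheory.indicatorConstLp_coeFn
  rw [h]
  simp [Set.indicator_apply]

theorem sub_P_apply (hT : G.IsTree) (o : V) (lam : ℂ) (u : W.ell2 hT o) (x : V) :
    ((algebraMap ℂ (W.ell2 hT o →L[ℂ] W.ell2 hT o) lam - W.P hT o) u : V → ℂ) x
      = lam * u x - ∑' y, (W.p x y : ℂ) * u y := by
  rw [sub_apply, Algebra.algebraMap_eq_smul_one]
  have h1 := congrFun (W.eq_of_ae_eq hT (MeasureTheory.Lp.coeFn_sub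
    ((lam • (1 : W.ell2 hT o →L[ℂ] W.ell2 hT o)) u) (W.P hT o u))) x
  have h2 := congrFun (W.eq_of_ae_eq hT (MeasureTheory.Lp.coeFn_smul lam u)) x
  rw [h1, Pi.sub_apply, P_apply]
  congr 1

open Classical in
theorem green_resolvent_eq (hT : G.IsTree) (o : V) {lam : ℂ}
    (hlam : lam ∈ resolventSet ℂ (W.P hT o)) (x y : V) :
    HasSum (fun w => (W.p x w : ℂ) * W.green hT o lam w y)
      (lam * W.green hT o lam x y - if x = y then 1 else 0) := by
  have h1 : (algebraMap ℂ _ lam - W.P hT o) (resolvent (W.P hT o) lam (W.delta hT o y))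
      = W.delta hT o y := by
    rw [← mul_apply_eq_comp, resolvent, Ring.mul_inverse_cancel _ hlam,
      one_apply_eq_self]
  have h2 := W.sub_P_apply hT o lam (resolvent (W.P hT o) lam (W.delta hT o y)) x
  rw [h1, delta_apply] at h2
  rw [h2, green, sub_sub_cancel]
  exact (W.summable_act hT o _ x).hasSum

open Classical in
/-- The multiples of `G(·,w|lam)` are the only solutions in `ℓ²(T,m)` of `(lam I - P) u = c 𝟏_w`. -/
theorem eq_mul_green (hT : G.IsTree) (o : V) {lam : ℂ}
    (hlam : lam ∈ resolventSet ℂ (W.P hT o)) {u : W.ell2 hT o} {c : ℂ} {w : V}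
    (hu : ∀ x, lam * u x - ∑' y, (W.p x y : ℂ) * u y = c * if x = w then 1 else 0) (x : V) :
    (u : V → ℂ) x = c * W.green hT o lam x w := by
  have h1 : (algebraMap ℂ _ lam - W.P hT o) u = c • W.delta hT o w := by
    refine MeasureTheory.Lp.ext (Filter.Eventually.of_forall fun x => ?_)
    have h2 := congrFun (W.eq_of_ae_eq hT (MeasureTheory.Lp.coeFn_smul c (W.delta hT o w))) x
    rw [sub_P_apply, hu, h2, Pi.smul_apply, delta_apply, smul_eq_mul]
  have h3 : u = c • resolvent (W.P hT o) lam (W.delta hT o w) := by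
    rw [← map_smul, ← h1, ← mul_apply_eq_comp, resolvent,
      Ring.inverse_mul_cancel _ hlam, one_apply_eq_self]
  rw [h3, congrFun (W.eq_of_ae_eq hT (MeasureTheory.Lp.coeFn_smul c _)) x, Pi.smul_apply,
    smul_eq_mul, green]

/-- Restricted to `C`, the function `G(·,y) - (G(w,y)/G(w,w)) G(·,w)` solves `(lam I - P) u = c 𝟏_w`
and vanishes at `w`, so that it is zero. -/
theorem green_cut (hT : G.IsTree) (o : V) {lam : ℂ} (hlam : lam ∈ W.resStar hT o) (C : Set V)
    (w : V) (hw : w ∉ C) (hC : ∀ z ∈ C, ∀ z', G.Adj z z' → z' ∈ C ∨ z' = w) (x : V) (hx : x ∈ C)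
    (y : V) (hy : y ∉ C) :
    W.green hT o lam x y * W.green hT o lam w w
      = W.green hT o lam x w * W.green hT o lam w y := by
  classical
  let _ : MeasurableSpace V := ⊤
  have hww := hlam.2 w
  set k : ℂ := W.green hT o lam w y / W.green hT o lam w w with hk
  set g : V → ℂ := fun z => W.green hT o lam z y - k * W.green hT o lam z w with hg
  have hgw : g w = 0 := by
    simp only [hg, hk]
    field_simp
    ring
  have hgL : MeasureTheory.MemLp g 2 (W.mMeasure hT o) :=
    (MeasureTheory.Lp.memLp (resolvent (W.P hT o) lam (W.delta hT o y))).sub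
      ((MeasureTheory.Lp.memLp (resolvent (W.P hT o) lam (W.delta hT o w))).const_mul k)
  have huL : MeasureTheory.MemLp (C.indicator g) 2 (W.mMeasure hT o) :=
    hgL.indicator MeasurableSpace.measurableSet_top
  have hu : (huL.toLp : V → ℂ) = C.indicator g := W.eq_of_ae_eq hT huL.coeFn_toLp
  have heq : ∀ z, C.indicator g z =
      (-∑' v, (W.p w v : ℂ) * C.indicator g v) * W.green hT o lam z w := by
    intro z
    rw [← hu]
    refine W.eq_mul_green hT o hlam.1 (fun z => ?_) z
    rw [hu]
    by_cases hzw : z = w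
    · subst hzw
      simp [hw]
    rw [if_neg hzw, mul_zero, sub_eq_zero]
    by_cases hz : z ∈ C
    · have h1 : ∀ v, (W.p z v : ℂ) * C.indicator g v = (W.p z v : ℂ) * g v := by
        intro v
        by_cases hv : v ∈ C
        · rw [Set.indicator_of_mem hv]
        · rw [Set.indicator_of_notMem hv]
          by_cases hzv : G.Adj z v
          · rw [(hC z hz v hzv).resolve_left hv, hgw]
          · simp [W.p_eq_zero hzv]
      have h2 := (W.green_resolvent_eq hT o hlam.1 z y).sub
        ((W.green_resolvent_eq hT o hlam.1 z w).mul_left k)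
      rw [if_neg hzw, if_neg (fun h : z = y => hy (h ▸ hz))] at h2
      rw [Set.indicator_of_mem hz, tsum_congr h1]
      refine Eq.trans ?_ h2.tsum_eq.symm |>.trans (tsum_congr fun v => ?_)
      · simp only [hg]
        ring
      · simp only [hg]
        ring
    · rw [Set.indicator_of_notMem hz, mul_zero, eq_comm]
      convert tsum_zero with v
      by_cases hv : v ∈ C
      · have hzv : ¬ G.Adj z v := fun h => (hC v hv z h.symm).elim hz hzw
        simp [W.p_eq_zero hzv]
      · simp [hv]
  have hc : (-∑' v, (W.p w v : ℂ) * C.indicator g v) = 0 := by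
    have h1 := heq w
    rw [Set.indicator_of_notMem hw] at h1
    exact (mul_eq_zero.1 h1.symm).resolve_right hww
  have h1 := heq x
  rw [hc, zero_mul, Set.indicator_of_mem hx] at h1
  simp only [hg, hk] at h1
  field_simp at h1
  linear_combination h1

theorem isGreenKernel_green (hT : G.IsTree) (o : V) {lam : ℂ} (hlam : lam ∈ W.resStar hT o) :
    IsGreenKernel W lam (W.green hT o lam) where
  resolvent_eq := W.green_resolvent_eq hT o hlam.1
  diag_ne_zero := hlam.2
  cut := W.green_cut hT o hlam

/-! ### Transition probabilities and the spectral radius -/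

theorem pn_nonneg (n : ℕ) (x y : V) : 0 ≤ W.pn n x y := by
  induction n generalizing x with
  | zero => unfold pn; split_ifs <;> norm_num
  | succ n ih => exact tsum_nonneg fun z => mul_nonneg (W.nonneg x z) (ih z)

theorem pn_le_one (n : ℕ) (x y : V) : W.pn n x y ≤ 1 := by
  induction n generalizing x with
  | zero => unfold pn; split_ifs <;> norm_num
  | succ n ih =>
    have hle : ∀ z, W.p x z * W.pn n z y ≤ W.p x z := fun z =>
      mul_le_of_le_one_right (W.nonneg x z) (ih z)
    rw [← (W.hasSum x).tsum_eq]
    exact (Summable.of_nonneg_of_le (fun z => mul_nonneg (W.nonneg x z) (W.pn_nonneg n z y)) hle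
      (W.hasSum x).summable).tsum_le_tsum hle (W.hasSum x).summable

theorem hasSum_pn (n : ℕ) (x y : V) :
    HasSum (fun z => W.p x z * W.pn n z y) (W.pn (n + 1) x y) :=
  (Summable.of_nonneg_of_le (fun z => mul_nonneg (W.nonneg x z) (W.pn_nonneg n z y))
    (fun z => mul_le_of_le_one_right (W.nonneg x z) (W.pn_le_one n z y))
    (W.hasSum x).summable).hasSum

theorem pn_one (x y : V) : W.pn 1 x y = W.p x y := by
  classical
  refine (W.hasSum_pn 0 x y).unique ?_
  convert hasSum_single y fun z hz => ?_
  · simp [pn]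
  · simp [pn, hz]

theorem pn_mul_pn_le (m n : ℕ) (x y z : V) : W.pn m x y * W.pn n y z ≤ W.pn (m + n) x z := by
  induction m generalizing x with
  | zero =>
    by_cases h : x = y
    · subst h
      simp [pn]
    · simpa [pn, h] using W.pn_nonneg n x z
  | succ m ih =>
    rw [show m + 1 + n = m + n + 1 by omega]
    refine hasSum_le (fun v => ?_) ((W.hasSum_pn m x y).mul_right (W.pn n y z))
      (W.hasSum_pn (m + n) x z)
    rw [mul_assoc]
    exact mul_le_mul_of_nonneg_left (ih v) (W.nonneg x v)

theorem pn_two_pos (x : V) : 0 < W.pn 2 x x := by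
  obtain ⟨y, hy⟩ := W.exists_adj x
  refine lt_of_lt_of_le ?_ (W.pn_mul_pn_le 1 1 x y x)
  rw [pn_one, pn_one]
  exact mul_pos ((W.pos_iff _ _).2 hy) ((W.pos_iff _ _).2 hy.symm)

/-- The spectral radius is positive: it is at least the square root of `p⁽²⁾(o,o)`. -/
theorem rho_pos (o : V) : 0 < W.rho o := by
  set c := W.pn 2 o o with hc
  have hcpos : 0 < c := W.pn_two_pos o
  have hpow : ∀ n : ℕ, c ^ n ≤ W.pn (2 * n) o o := by
    intro n
    induction n with
    | zero => simp [pn]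
    | succ n ih =>
      rw [pow_succ]
      exact (mul_le_mul_of_nonneg_right ih hcpos.le).trans (W.pn_mul_pn_le (2 * n) 2 o o o)
  have hfreq : ∃ᶠ n : ℕ in Filter.atTop, c ^ (1 / 2 : ℝ) ≤ W.pn n o o ^ (1 / (n : ℝ)) := by
    refine Filter.frequently_atTop.2 fun N => ⟨2 * (N + 1), by omega, ?_⟩
    have h1 := Real.rpow_le_rpow (by positivity) (hpow (N + 1))
      (z := 1 / ((2 * (N + 1) : ℕ) : ℝ)) (by positivity)
    refine le_trans (le_of_eq ?_) h1
    rw [← Real.rpow_natCast, ← Real.rpow_mul hcpos.le]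
    congr 1
    push_cast
    field_simp
  have hbdd : Filter.IsBoundedUnder (· ≤ ·) Filter.atTop
      fun n : ℕ => W.pn n o o ^ (1 / (n : ℝ)) :=
    Filter.isBoundedUnder_of ⟨1, fun n =>
      Real.rpow_le_one (W.pn_nonneg n o o) (W.pn_le_one n o o) (by positivity)⟩
  exact lt_of_lt_of_le (Real.rpow_pos_of_pos hcpos _)
    (Filter.le_limsup_of_frequently_le hfreq hbdd)

/-- Since `T` is bipartite, `p⁽ⁿ⁾(x,y)` vanishes unless `n` has the parity of the distance. -/
theorem even_of_pn_ne_zero (hT : G.IsTree) (o : V) {n : ℕ} {x y : V} (h : W.pn n x y ≠ 0) :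
    Even (n + level hT o x + level hT o y) := by
  induction n generalizing x with
  | zero =>
    have hxy : x = y := by
      by_contra hne
      exact h (by simp [pn, hne])
    subst hxy
    exact ⟨level hT o x, by omega⟩
  | succ n ih =>
    obtain ⟨z, hz⟩ : ∃ z, W.p x z * W.pn n z y ≠ 0 := by
      by_contra hcon
      push Not at hcon
      exact h (by simp [pn, hcon])
    have hadj : G.Adj x z := by
      by_contra hn
      exact hz (by rw [W.p_eq_zero hn, zero_mul])
    have h1 := ih (right_ne_zero_of_mul hz)
    have h2 : level hT o z = level hT o x + 1 ∨ level hT o x = level hT o z + 1 := by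
      rcases adj_cases hT o hadj with h3 | h3
      · have h4 := level_pred hT h3.1
        rw [h3.2] at h4
        exact Or.inl h4
      · have h4 := level_pred hT h3.1
        rw [h3.2] at h4
        exact Or.inr h4
    rw [Nat.even_iff] at h1 ⊢
    omega

/-! ### The Green function at the spectral radius -/

/-- The coefficients of the product of the power series of `G(x,a)` and `G(b,c)`. -/
noncomputable def convolution (a b c : V) (n : ℕ) (x : V) : ℝ :=
  ∑ q ∈ Finset.HasAntidiagonal.antidiagonal n, W.pn q.1 x a * W.pn q.2 b c

theorem hasSum_convolution (a b c : V) (n : ℕ) (x : V) :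
    HasSum (fun z => W.p x z * W.convolution a b c n z)
      (W.convolution a b c (n + 1) x - W.pn 0 x a * W.pn (n + 1) b c) := by
  unfold convolution
  rw [Finset.Nat.sum_antidiagonal_succ, add_sub_cancel_left]
  simp only [Finset.mul_sum, ← mul_assoc]
  exact hasSum_sum fun q _ => (W.hasSum_pn q.1 x a).mul_right _

/-- Multiplicativity along cut points, coefficient by coefficient: inside `C` both sides satisfy
the same recursion, and on the cut point `w` they agree by symmetry of the convolution. -/
theorem convolution_cut {C : Set V} {w : V} (hw : w ∉ C)
    (hC : ∀ z ∈ C, ∀ z', G.Adj z z' → z' ∈ C ∨ z' = w) {y : V} (hy : y ∉ C) (n : ℕ) {x : V}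
    (hx : x ∈ C) : W.convolution y w w n x = W.convolution w w y n x := by
  have hboundary : ∀ n, W.convolution y w w n w = W.convolution w w y n w := fun n => by
    unfold convolution
    rw [← Finset.Nat.sum_antidiagonal_swap]
    exact Finset.sum_congr rfl fun q _ => mul_comm _ _
  have hxy : ∀ x ∈ C, W.pn 0 x y = 0 ∧ W.pn 0 x w = 0 := fun x hx => by
    constructor
    · simp [pn, show x ≠ y from fun h => hy (h ▸ hx)]
    · simp [pn, show x ≠ w from fun h => hw (h ▸ hx)]
  induction n generalizing x with
  | zero => simp [convolution, hxy x hx]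
  | succ n ih =>
    have h1 := W.hasSum_convolution y w w n x
    have h2 := W.hasSum_convolution w w y n x
    rw [(hxy x hx).1, zero_mul, sub_zero] at h1
    rw [(hxy x hx).2, zero_mul, sub_zero] at h2
    refine h1.unique ?_
    convert h2 using 1
    funext z
    by_cases hz : G.Adj x z
    · rcases hC x hx z hz with h | rfl
      · rw [ih h]
      · rw [hboundary]
    · rw [W.p_eq_zero hz, zero_mul, zero_mul]

theorem norm_greenSeries_term (lam : ℂ) (n : ℕ) (x y : V) :
    ‖(W.pn n x y : ℂ) / lam ^ (n + 1)‖ = W.pn n x y / ‖lam‖ ^ (n + 1) := by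
  rw [norm_div, norm_pow, Complex.norm_real, Real.norm_of_nonneg (W.pn_nonneg n x y)]

variable {W} in
theorem summable_greenSeries {lam : ℂ}
    (hs : ∀ x y, Summable fun n : ℕ => W.pn n x y / ‖lam‖ ^ (n + 1)) (x y : V) :
    Summable fun n : ℕ => ‖(W.pn n x y : ℂ) / lam ^ (n + 1)‖ := by
  simpa only [norm_greenSeries_term] using hs x y

variable {W} in
theorem greenSeries_mul {lam : ℂ}
    (hs : ∀ x y, Summable fun n : ℕ => W.pn n x y / ‖lam‖ ^ (n + 1)) (x a b c : V) :
    W.greenSeries lam x a * W.greenSeries lam b c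
      = ∑' n : ℕ, (W.convolution a b c n x : ℂ) / lam ^ (n + 2) := by
  unfold greenSeries
  rw [tsum_mul_tsum_eq_tsum_sum_antidiagonal_of_summable_norm (summable_greenSeries hs x a)
    (summable_greenSeries hs b c)]
  refine tsum_congr fun n => ?_
  unfold convolution
  push_cast
  rw [Finset.sum_div]
  refine Finset.sum_congr rfl fun q hq => ?_
  rw [div_mul_div_comm, ← pow_add, ← Finset.HasAntidiagonal.mem_antidiagonal.1 hq]
  congr 2
  omega

open Classical in
variable {W} in
theorem greenSeries_resolvent_eq {lam : ℂ} (h0 : lam ≠ 0)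
    (hs : ∀ x y, Summable fun n : ℕ => W.pn n x y / ‖lam‖ ^ (n + 1)) (x y : V) :
    HasSum (fun w => (W.p x w : ℂ) * W.greenSeries lam w y)
      (lam * W.greenSeries lam x y - if x = y then 1 else 0) := by
  set f : ℕ × V → ℂ := fun q => (W.p x q.2 : ℂ) * ((W.pn q.1 q.2 y : ℂ) / lam ^ (q.1 + 1)) with hf
  have hrow : ∀ n, HasSum (fun w => f (n, w)) ((W.pn (n + 1) x y : ℂ) / lam ^ (n + 1)) := by
    intro n
    have h1 := (Complex.hasSum_ofReal.2 (W.hasSum_pn n x y)).div_const (lam ^ (n + 1))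
    refine hasSum_of_eq h1 (fun w => ?_) rfl
    simp only [hf]
    push_cast
    ring
  have hnorm : ∀ n, HasSum (fun w => ‖f (n, w)‖) (W.pn (n + 1) x y / ‖lam‖ ^ (n + 1)) := by
    intro n
    refine hasSum_of_eq ((W.hasSum_pn n x y).div_const (‖lam‖ ^ (n + 1))) (fun w => ?_) rfl
    simp only [hf]
    rw [norm_mul, norm_greenSeries_term, Complex.norm_real, Real.norm_of_nonneg (W.nonneg x w)]
    ring
  have hsum : Summable f := by
    refine Summable.of_norm ((summable_prod_of_nonneg fun q => norm_nonneg _).2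
      ⟨fun n => (hnorm n).summable, ?_⟩)
    simp only [(hnorm _).tsum_eq]
    refine (((summable_nat_add_iff 1).2 (hs x y)).mul_left ‖lam‖).congr fun n => ?_
    rw [pow_succ _ (n + 1)]
    field_simp
  have hcol : ∀ w, HasSum (fun n => f (n, w)) ((W.p x w : ℂ) * W.greenSeries lam w y) := fun w =>
    ((summable_greenSeries hs w y).of_norm.hasSum).mul_left _
  have htotal : ∑' q, f q = lam * W.greenSeries lam x y - if x = y then 1 else 0 := by
    have h1 := (hsum.hasSum.prod_fiberwise hrow).tsum_eq
    have h2 := (summable_greenSeries hs x y).of_norm.tsum_eq_zero_add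
    rw [← h1, greenSeries, h2, mul_add, ← tsum_mul_left]
    have h3 : lam * ((W.pn 0 x y : ℂ) / lam ^ (0 + 1)) = if x = y then 1 else 0 := by
      unfold pn
      split_ifs <;> simp [h0]
    rw [h3, add_sub_cancel_left]
    refine tsum_congr fun n => ?_
    rw [pow_succ _ (n + 1)]
    field_simp
  rw [← htotal]
  have h4 := (Equiv.prodComm V ℕ).hasSum_iff.2 hsum.hasSum
  exact h4.prod_fiberwise hcol

theorem greenSeries_diag_ne_zero (hT : G.IsTree) (o : V) {ρ : ℝ} (hρ : 0 < ρ) {lam : ℂ}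
    (hlam : lam = ρ ∨ lam = -ρ) (hs : ∀ x y, Summable fun n : ℕ => W.pn n x y / ρ ^ (n + 1))
    (x : V) : W.greenSeries lam x x ≠ 0 := by
  have hpos : 0 < ∑' n : ℕ, W.pn n x x / ρ ^ (n + 1) :=
    (hs x x).tsum_pos (fun n => div_nonneg (W.pn_nonneg n x x) (by positivity)) 0
      (by simp [pn, hρ])
  have hne := Complex.ofReal_ne_zero.2 hpos.ne'
  rcases hlam with rfl | rfl
  · convert hne
    unfold greenSeries
    push_cast
    rfl
  · -- Only even `n` contribute on the diagonal, so `G(x,x|-ρ) = -G(x,x|ρ)`.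
    convert neg_ne_zero.2 hne
    unfold greenSeries
    push_cast
    rw [← tsum_neg]
    refine tsum_congr fun n => ?_
    by_cases h : W.pn n x x = 0
    · simp [h]
    · have h1 := W.even_of_pn_ne_zero hT o h
      have h2 : Odd (n + 1) := by
        rw [Nat.even_iff] at h1
        rw [Nat.odd_iff]
        omega
      rw [h2.neg_pow, div_neg]

theorem isGreenKernel_greenSeries (hT : G.IsTree) (o : V) (ht : W.RhoTransient o) {lam : ℂ}
    (hlam : lam = W.rho o ∨ lam = -W.rho o) : IsGreenKernel W lam (W.greenSeries lam) := by
  have hρ := W.rho_pos o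
  have hnorm : ‖lam‖ = W.rho o := by
    rcases hlam with rfl | rfl <;> simp [hρ.le]
  have h0 : lam ≠ 0 := norm_ne_zero_iff.1 (hnorm ▸ hρ.ne')
  have hs : ∀ x y, Summable fun n : ℕ => W.pn n x y / ‖lam‖ ^ (n + 1) := hnorm ▸ ht
  refine ⟨greenSeries_resolvent_eq h0 hs, W.greenSeries_diag_ne_zero hT o hρ hlam ht,
    fun C w hw hC x hx y hy => ?_⟩
  rw [greenSeries_mul hs, greenSeries_mul hs]
  exact tsum_congr fun n => by rw [W.convolution_cut hw hC hy n hx]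

theorem IsGreenAt.isGreenKernel {W : NNWalk G} {hT : G.IsTree} {o : V} {lam : ℂ} {Gr : V → V → ℂ}
    (h : W.IsGreenAt hT o lam Gr) : IsGreenKernel W lam Gr := by
  rcases h with ⟨h, rfl⟩ | ⟨ht, hlam, rfl⟩
  · exact W.isGreenKernel_green hT o h
  · exact W.isGreenKernel_greenSeries hT o ht hlam

end NNWalk

end TreeWalk

theorem corollary3p5 {V : Type*} [Countable V] {G : SimpleGraph V} (hT : G.IsTree)
    (hleaf : ∀ x, (G.neighborSet x).encard ≠ 1) (W : TreeWalk.NNWalk G) (o : V)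
    (lam : ℂ) (Gr : V → V → ℂ) (hGr : W.IsGreenAt hT o lam Gr)
    (h : V → ℂ) (hh : W.IsHarmonic lam h) :
    -- all denominators occurring in the kernel and in the formula for `ν` are nonzero
    (∀ x y, Gr x y ≠ 0) ∧
    (∀ x, x ≠ o → 1 - TreeWalk.greenWeight Gr (TreeWalk.pred hT o x) x *
      TreeWalk.greenWeight Gr x (TreeWalk.pred hT o x) ≠ 0) ∧
    ∃ ν : TreeWalk.Distribution G,
      (TreeWalk.IsStrong hT o ν ∧
        ∀ x, TreeWalk.HasBoundaryIntegral ν (TreeWalk.martinKernel hT o Gr x) (h x)) ∧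
      (∀ ν' : TreeWalk.Distribution G, TreeWalk.IsStrong hT o ν' →
        (∀ x, TreeWalk.HasBoundaryIntegral ν' (TreeWalk.martinKernel hT o Gr x) (h x)) →
        ν' = ν) ∧
      TreeWalk.arcMass hT o ν o = h o ∧
      ∀ x, x ≠ o → TreeWalk.arcMass hT o ν x =
        TreeWalk.greenWeight Gr o x *
          (h x - TreeWalk.greenWeight Gr x (TreeWalk.pred hT o x) * h (TreeWalk.pred hT o x)) /
          (1 - TreeWalk.greenWeight Gr (TreeWalk.pred hT o x) x *
            TreeWalk.greenWeight Gr x (TreeWalk.pred hT o x)) := by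
  have hK := hGr.isGreenKernel
  have hmass := hK.hasSum_harmonicMass hT o hh
  obtain ⟨ν, hν⟩ := TreeWalk.exists_distribution hT o (W.forward_nonempty hT hleaf o) hmass
  refine ⟨hK.ne_zero hT, fun x hx => hK.one_sub_ne_zero hT (TreeWalk.adj_pred hT hx), ν,
    ⟨TreeWalk.isStrong_of_hasSum hT o fun x => ?_, (hK.represents_iff hT o h ν).2 hν⟩,
    fun ν' _ hν' => TreeWalk.distribution_ext hT o fun x => ?_, ?_, fun x hx => ?_⟩
  · simpa only [hν] using hmass x
  · rw [hν, (hK.represents_iff hT o h ν').1 hν']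
  · rw [hν, TreeWalk.harmonicMass, if_pos rfl]
  · rw [hν, TreeWalk.harmonicMass, if_neg hx]
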